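/- Conventions. For an Ore domain $R$ (a two-sided Ore domain) $\operatorname{Frac} R$ denotes its skew field of fractions and $Z(R)$ its center. For a field $k$, the Weyl algebra $A_n(k)$ is generated over $k$ by $x_1,\dots,x_n,y_1,\dots,y_n$ with relations $[x_i,x_j]=[y_i,y_j]=0$, $[y_i,x_j]=\delta_{ij}$, and $\mathbb D_{n,l}(k)=\operatorname{Frac} A_n(k(t_1,\dots,t_l))$. For a $k$-algebra $A$, $\operatorname{Tdeg} A=\sup_V\inf_b \operatorname{GKdim} k[bV]$ is the Gelfand–Kirillov transcendence degree, where $V$ runs over the finite-dimensional subspaces and $b$ over the regular elements of $A$; $\operatorname{tdeg}$ is the transcendence degree of fields. A $\mathbb Z$-compatible family $\mathcal K=\{A_k\}$, $k$ ranging over all algebraically closed fields, is given by a ring $A_{\mathbb Z}$ with $A_k=A_{\mathbb Z}\otimes_{\mathbb Z}k$ such that: 1. $A_{\mathbb Z}$ and all $A_k$ are Ore domains. 2. $A_{\mathbb Z}$ has a finitely generated $\mathbb Z$-submodule $V$ (the degree-one generators; $1\in V$ is allowed but not required) such that the modules $A_i^{\mathbb Z}=(\mathbb Z+V)^i$, $i\ge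 0$, are finitely generated and free over $\mathbb Z$, $A_0^{\mathbb Z}=\mathbb Z$ and $\bigcup_i A_i^{\mathbb Z}=A_{\mathbb Z}$. For every algebraically closed $k$ the maps $A_i^{\mathbb Z}\otimes k\to A_k$ and $V\otimes k\to A_k$ are injective, so that the $A_i^k=A_i^{\mathbb Z}\otimes k$ form a finite-dimensional filtration of $A_k$. 3. If $\operatorname{char} k=0$, then $Z(\operatorname{Frac} A_k)\cong\operatorname{Frac} Z(A_k)$ as $k$-algebras. 4. For every algebraically closed $k$, $\operatorname{Tdeg}\operatorname{Frac}A_k=\dim_k (V\otimes k)$. 5. There are $z_1,\dots,z_s\in A_{\mathbb Z}$ such that, for every algebraically closed $k$ of characteristic $0$, $Z(A_k)$ is the polynomial algebra $k[z_1,\dots,z_s]$, and such that the images of $z_1,\dots,z_s$ in $A_F$ are central for every algebraically closed $F$ of prime characteristic. For $k$ algebraically closed of characteristic $0$, the Gelfand–Kirillov Conjecture holds for $A_k$ if there are $n,l\ge 0$ with $\operatorname{Frac}A_k\cong\mathbb D_{n,l}(k)$ as $k$-algebras, $\operatorname{Tdeg}\operatorname{Frac}A_k=2n+l$ and $l=\operatorname{tdeg}\operatorname{Frac}Z(A_k)$.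 For $F$ algebraically closed of prime characteristic, the modular Gelfand–Kirillov Conjecture holds for $A_F$ if $\operatorname{Frac}A_F$ is a Weyl field over a purely transcendental extension of $F$, that is, $\operatorname{Frac}A_F\cong\mathbb D_{n,l}(F)$ as $F$-algebras for some $n,l\ge 0$. **Theorem.** Let $\mathcal K=\{A_k\}$ be a $\mathbb Z$-compatible family. Suppose that the Gelfand–Kirillov Conjecture holds for $A_k$ for some algebraically closed field $k$ of characteristic $0$. Then it holds for $A_k$ for every algebraically closed field $k$ of characteristic $0$, and there is $N$, depending only on $\mathcal K$, such that for every prime $p>N$ and every algebraically closed field $F$ of characteristic $p$ the modular Gelfand–Kirillov Conjecture holds for $A_F$. -/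

import Mathlib

universe u v

open scoped TensorProduct nonZeroDivisors

noncomputable section

namespace GK

/-! ### Ore domains and their skew fields of fractions -/

/-- A (two-sided) Ore domain. -/
class IsOreDomain (R : Type*) [Ring R] : Prop where
  isDomain : IsDomain R
  left_ore : ∀ a b : R, b ≠ 0 → ∃ c d : R, d ≠ 0 ∧ d * a = c * b
  right_ore : ∀ a b : R, b ≠ 0 → ∃ c d : R, d ≠ 0 ∧ a * d = b * c

attribute [instance] IsOreDomain.isDomain

/-- The nonzero elements of an Ore domain form an Ore set. -/
instance IsOreDomain.oreSet (R : Type*) [Ring R] [IsOreDomain R] :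
    OreLocalization.OreSet R⁰ :=
  Classical.choice <| OreLocalization.nonempty_oreSet_iff_of_noZeroDivisors.mpr fun r s => by
    obtain ⟨c, d, hd, h⟩ := IsOreDomain.left_ore r (s : R) (nonZeroDivisors.coe_ne_zero s)
    exact ⟨c, ⟨d, mem_nonZeroDivisors_of_ne_zero hd⟩, h⟩

/-- The skew field of fractions `Frac R` of an Ore domain `R`. -/
abbrev SkewFrac (R : Type*) [Ring R] [IsOreDomain R] : Type _ :=
  OreLocalization R⁰ R

/-- The homomorphism `f` exhibits the skew field `D` as the skew field of fractions of `R`: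
it is injective and every element of `D` has the form `f(s)⁻¹ f(a)` with `s ≠ 0`. -/
def IsSkewFractionMap {R D : Type*} [Ring R] [DivisionRing D] (f : R →+* D) : Prop :=
  Function.Injective f ∧ ∀ q : D, ∃ a s : R, s ≠ 0 ∧ q = (f s)⁻¹ * f a

/-! ### Weyl algebras and Weyl fields -/

/-- The defining relations of the `n`-th Weyl algebra; `Sum.inl i` stands for `x_i` and
`Sum.inr i` for `y_i`. -/
inductive WeylRel (K : Type u) [CommRing K] (n : ℕ) :
    FreeAlgebra K (Fin n ⊕ Fin n) → FreeAlgebra K (Fin n ⊕ Fin n) → Prop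
  | x_comm (i j : Fin n) : WeylRel K n
      (FreeAlgebra.ι K (Sum.inl i) * FreeAlgebra.ι K (Sum.inl j))
      (FreeAlgebra.ι K (Sum.inl j) * FreeAlgebra.ι K (Sum.inl i))
  | y_comm (i j : Fin n) : WeylRel K n
      (FreeAlgebra.ι K (Sum.inr i) * FreeAlgebra.ι K (Sum.inr j))
      (FreeAlgebra.ι K (Sum.inr j) * FreeAlgebra.ι K (Sum.inr i))
  | y_x (i j : Fin n) : WeylRel K n
      (FreeAlgebra.ι K (Sum.inr i) * FreeAlgebra.ι K (Sum.inl j))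
      (FreeAlgebra.ι K (Sum.inl j) * FreeAlgebra.ι K (Sum.inr i) + if i = j then 1 else 0)

/-- The `n`-th Weyl algebra `A_n(K)`. -/
abbrev WeylAlgebra (K : Type u) [CommRing K] (n : ℕ) : Type u :=
  RingQuot (WeylRel K n)

/-- The purely transcendental extension `k(t_1, …, t_l)`. -/
abbrev RatFun (k : Type u) [Field k] (l : ℕ) : Type u :=
  FractionRing (MvPolynomial (Fin l) k)

/-- `D` is isomorphic, as a `k`-algebra, to the Weyl field `𝔻_{n,l}(k)`, the skew field of
fractions of `A_n(k(t_1, …, t_l))`. -/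
def IsWeylField (k : Type u) [Field k] (n l : ℕ) (D : Type*) [DivisionRing D] [Algebra k D] :
    Prop :=
  ∃ f : WeylAlgebra (RatFun k l) n →ₐ[k] D, IsSkewFractionMap f.toRingHom

/-! ### Gelfand–Kirillov dimension and transcendence degree -/

/-- The Gelfand–Kirillov dimension: the supremum over finite-dimensional subspaces `W` of
`limsup_n log_n dim (k + W)^n`. -/
def gkDim (k : Type*) (A : Type*) [Field k] [Ring A] [Algebra k A] : EReal :=
  ⨆ (W : Submodule k A) (_ : W.FG),
    Filter.limsup
      (fun n : ℕ =>
        ((Real.log (Module.finrank k ↥((1 ⊔ W) ^ n : Submodule k A)) / Real.log n : ℝ) : EReal))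
      Filter.atTop

/-- The Gelfand–Kirillov transcendence degree `sup_V inf_b GKdim k[bV]`, with `V` running over the
finite-dimensional subspaces and `b` over the regular elements. -/
def tdeg (k : Type*) (A : Type*) [Field k] [Ring A] [Algebra k A] : EReal :=
  ⨆ (V : Submodule k A) (_ : V.FG), ⨅ b ∈ A⁰,
    gkDim k (Algebra.adjoin k ((fun v => b * v) '' (V : Set A)))

/-! ### `ℤ`-compatible families -/

/-- A `ℤ`-compatible family `{A_k}` of algebras, `A_k = k ⊗ A_ℤ` for algebraically closed `k`.

`gen` is the degree-one part of the filtration. It may contain `1`, and then `fil i = gen ^ i` for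
`i ≥ 1`; but `1` may also be left out, as for the subspace `𝔤` of an enveloping algebra `U(𝔤)`. -/
structure ZCompatibleFamily where
  /-- the ring `A_ℤ` -/
  ring : Type v
  [instRing : Ring ring]
  [ore_int : IsOreDomain ring]
  [ore : ∀ (k : Type u) [Field k] [IsAlgClosed k], IsOreDomain (k ⊗[ℤ] ring)]
  /-- the degree-one part of `A_ℤ` -/
  gen : Submodule ℤ ring
  gen_fg : gen.FG
  /-- the filtration `A_i^ℤ` of `A_ℤ` -/
  fil : ℕ → Submodule ℤ ring
  fil_eq : ∀ i, fil i = (1 ⊔ gen) ^ i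
  /-- `A_0 = ℤ` -/
  int_injective : Function.Injective (Int.cast : ℤ → ring)
  fil_finite : ∀ i, Module.Finite ℤ (fil i)
  fil_free : ∀ i, Module.Free ℤ (fil i)
  fil_exhaustive : ⨆ i, fil i = ⊤
  /-- `k ⊗ A_i^ℤ` is a subspace of `A_k`, so that these subspaces filter `A_k` -/
  fil_baseChange : ∀ (k : Type u) [Field k] [IsAlgClosed k] (i : ℕ),
    Function.Injective ((fil i).subtype.baseChange k)
  gen_baseChange : ∀ (k : Type u) [Field k] [IsAlgClosed k],
    Function.Injective (gen.subtype.baseChange k)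
  center_frac : ∀ (k : Type u) [Field k] [IsAlgClosed k] [CharZero k],
    Nonempty (Subalgebra.center k (SkewFrac (k ⊗[ℤ] ring)) ≃ₐ[k]
      FractionRing (Subalgebra.center k (k ⊗[ℤ] ring)))
  tdeg_frac : ∀ (k : Type u) [Field k] [IsAlgClosed k],
    tdeg k (SkewFrac (k ⊗[ℤ] ring)) = (Module.finrank k (gen.baseChange k) : EReal)
  /-- the number of generators of the center in characteristic `0` -/
  numCentral : ℕ
  /-- the generators of the center in characteristic `0` -/
  central : Fin numCentral → ring
  center_polynomial : ∀ (k : Type u) [Field k] [IsAlgClosed k] [CharZero k],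
    ∃ e : MvPolynomial (Fin numCentral) k ≃ₐ[k] Subalgebra.center k (k ⊗[ℤ] ring),
      ∀ i, (e (MvPolynomial.X i) : k ⊗[ℤ] ring) = 1 ⊗ₜ central i
  central_mem : ∀ (F : Type u) [Field F] [IsAlgClosed F] (p : ℕ) [Fact p.Prime] [CharP F p],
    ∀ i, (1 ⊗ₜ central i : F ⊗[ℤ] ring) ∈ Subalgebra.center F (F ⊗[ℤ] ring)

namespace ZCompatibleFamily

attribute [instance] instRing ore_int ore

/-- The member `A_k` of the family. -/
abbrev alg (K : ZCompatibleFamily.{u, v}) (k : Type u) [Field k] : Type (max u v) :=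
  k ⊗[ℤ] K.ring

/-- The Gelfand–Kirillov conjecture holds for `A_k` (`k` of characteristic `0`):
`Frac A_k ≅ 𝔻_{n,l}(k)`, where `Tdeg Frac A_k = 2n + l` and `l = tdeg Frac Z(A_k)`. -/
def GelfandKirillov (K : ZCompatibleFamily.{u, v}) (k : Type u) [Field k] [IsAlgClosed k] : Prop :=
  ∃ n l : ℕ, IsWeylField k n l (SkewFrac (K.alg k)) ∧
    tdeg k (SkewFrac (K.alg k)) = ((2 * n + l : ℕ) : EReal) ∧
    Algebra.trdeg k (FractionRing (Subalgebra.center k (K.alg k))) = l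

/-- The modular Gelfand–Kirillov conjecture holds for `A_F` (`F` of prime characteristic):
`Frac A_F` is a Weyl field over a purely transcendental extension of `F`. -/
def ModularGelfandKirillov (K : ZCompatibleFamily.{u, v}) (F : Type u) [Field F] [IsAlgClosed F] :
    Prop :=
  ∃ n l : ℕ, IsWeylField F n l (SkewFrac (K.alg F))

end ZCompatibleFamily

end GK

end

/-!
A presentation of `Frac A_k` as a Weyl field involves only finitely many elements of `k`. There is
a nonzero integer `m` such that, for every algebraically closed `F` in which `m ≠ 0`, these
elements lie in a valuation ring `O ⊆ k` with a homomorphism `O → F`. Because `O` is a valuation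
ring, Gauss's lemma shows that the elements of `A_O` with nonzero image in `A_F` form an Ore set,
so that `A_O → A_F` extends to a partial homomorphism from `Frac A_k` to `Frac A_F`. It carries
the generators of the Weyl field to elements of `Frac A_F` that satisfy the same relations and
generate `Frac A_F` as a skew field of fractions. Their ordered monomials are linearly independent
over `F`, since a linear relation would lower the growth exponent and force
`Tdeg Frac A_F < 2n + l`, whereas `Tdeg Frac A_F = rk V = Tdeg Frac A_k = 2n + l`. Hence
`Frac A_F ≅ 𝔻_{n,l}(F)`.
-/

noncomputable section

namespace GK

/-! ### Partial homomorphisms -/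

section PartialHom

variable {D E : Type*} [Ring D] [Ring E] {Γ : Subring (D × E)}

/-- A subring of `D × E` is the graph of a partial homomorphism from `D` to `E`, that is, of a
ring homomorphism from a subring of `D` to `E`, if it contains no `(0, y)` with `y ≠ 0`. -/
def IsPartialHom (Γ : Subring (D × E)) : Prop :=
  ∀ y : E, ((0 : D), y) ∈ Γ → y = 0

theorem isPartialHom_range_prod {P : Type*} [Ring P] {i : P →+* D} (hi : Function.Injective i)
    (j : P →+* E) : IsPartialHom (i.prod j).range := by
  rintro y ⟨p, hp⟩
  obtain ⟨hp₁, rfl⟩ := Prod.ext_iff.1 hp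
  rw [(injective_iff_map_eq_zero i).1 hi p hp₁]
  exact map_zero j

theorem exists_maximal_isPartialHom {Γ₀ : Subring (D × E)} (h₀ : IsPartialHom Γ₀) :
    ∃ Γ, Γ₀ ≤ Γ ∧ Maximal IsPartialHom Γ := by
  refine zorn_le_nonempty₀ {Γ | IsPartialHom Γ} ?_ Γ₀ h₀
  intro c hc hchain Γ₁ hΓ₁
  refine ⟨sSup c, fun y hy => ?_, fun Γ hΓ => le_sSup hΓ⟩
  rw [Subring.mem_sSup_of_directedOn ⟨Γ₁, hΓ₁⟩ hchain.directedOn] at hy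
  obtain ⟨Γ, hΓ, hy⟩ := hy
  exact hc hΓ y hy

namespace IsPartialHom

theorem eq_of_mem (h : IsPartialHom Γ) {x : D} {y y' : E} (hy : (x, y) ∈ Γ)
    (hy' : (x, y') ∈ Γ) : y = y' :=
  sub_eq_zero.1 <| h _ <| by simpa using sub_mem hy hy'

theorem fst_injective (h : IsPartialHom Γ) :
    Function.Injective ((RingHom.fst D E).comp Γ.subtype) := by
  rintro ⟨⟨x, y⟩, hy⟩ ⟨⟨x', y'⟩, hy'⟩ (rfl : x = x')
  obtain rfl := h.eq_of_mem hy hy'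
  rfl

theorem exists_hom (h : IsPartialHom Γ) :
    ∃ φ : Γ.map (RingHom.fst D E) →+* E, ∀ x : Γ.map (RingHom.fst D E), ((x : D), φ x) ∈ Γ := by
  let π : Γ →+* Γ.map (RingHom.fst D E) :=
    (RingHom.fst D E).restrict Γ _ fun _ hq => Subring.mem_map.2 ⟨_, hq, rfl⟩
  have hinj : Function.Injective π := fun p q hpq => h.fst_injective (congrArg Subtype.val hpq)
  have hsurj : Function.Surjective π := by
    rintro ⟨_, q, hq, rfl⟩
    exact ⟨⟨q, hq⟩, rfl⟩
  let e := RingEquiv.ofBijective π ⟨hinj, hsurj⟩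
  refine ⟨((RingHom.snd D E).comp Γ.subtype).comp e.symm, fun x => ?_⟩
  obtain ⟨q, rfl⟩ := e.surjective x
  rw [RingHom.comp_apply, RingHom.coe_coe, e.symm_apply_apply]
  exact q.2

end IsPartialHom

end PartialHom

section FractionGraph

variable {P D E : Type*} [Ring P] [Ring D] [Ring E] [IsDomain E] {f : P →+* D × E}
  {hore : ∀ a b : P, (f b).2 ≠ 0 → ∃ c d : P, (f d).2 ≠ 0 ∧ d * a = c * b}

/-- The correspondence `f : P → D × E` extended to left fractions: the pairs `q = f(s)⁻¹ f(a)`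
where the second component of `f(s)` is nonzero. The first component of `f(s)` need not be
invertible, so the fraction is encoded by `f(s) q = f(a)`. -/
def fractionGraph (f : P →+* D × E)
    (hore : ∀ a b : P, (f b).2 ≠ 0 → ∃ c d : P, (f d).2 ≠ 0 ∧ d * a = c * b) :
    Subring (D × E) where
  carrier := {q | ∃ s a : P, (f s).2 ≠ 0 ∧ f s * q = f a}
  zero_mem' := ⟨1, 0, by simp⟩
  one_mem' := ⟨1, 1, by simp⟩
  neg_mem' := by
    rintro q ⟨s, a, hs, hq⟩
    exact ⟨s, -a, hs, by rw [mul_neg, hq, map_neg]⟩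
  add_mem' := by
    rintro q q' ⟨s, a, hs, hq⟩ ⟨s', a', hs', hq'⟩
    obtain ⟨c, d, hd, hcd⟩ := hore s s' hs'
    refine ⟨d * s, d * a + c * a', by simp [hd, hs], ?_⟩
    rw [mul_add, map_add, map_mul f d a, ← hq, ← mul_assoc, ← map_mul, map_mul f c, ← hq',
      ← mul_assoc, ← map_mul, hcd]
  mul_mem' := by
    rintro q q' ⟨s, a, hs, hq⟩ ⟨s', a', hs', hq'⟩
    obtain ⟨c, d, hd, hcd⟩ := hore a s' hs'
    refine ⟨d * s, c * a', by simp [hd, hs], ?_⟩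
    rw [map_mul, mul_assoc, ← mul_assoc _ q, hq, ← mul_assoc, ← map_mul, hcd, map_mul, mul_assoc,
      hq', map_mul]

theorem apply_mem_fractionGraph (a : P) : f a ∈ fractionGraph f hore :=
  ⟨1, a, by simp⟩

theorem isPartialHom_fractionGraph (hf : Function.Injective fun p => (f p).1) :
    IsPartialHom (fractionGraph f hore) := by
  rintro y ⟨s, a, hs, h⟩
  obtain ⟨ha, hy⟩ := Prod.ext_iff.1 h
  have : a = 0 := hf (by simpa using ha.symm)
  simpa [this, hs] using hy

end FractionGraph

/-! ### Places -/

theorem nonempty_algHom_of_finiteType (F T : Type*) [Field F] [IsAlgClosed F] [CommRing T]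
    [Nontrivial T] [Algebra F T] [Algebra.FiniteType F T] : Nonempty (T →ₐ[F] F) := by
  obtain ⟨M, hM⟩ := Ideal.exists_maximal T
  let := Ideal.Quotient.field M
  have := finite_of_finite_type_of_isJacobsonRing F (T ⧸ M)
  exact ⟨(IsAlgClosed.lift : T ⧸ M →ₐ[F] F).comp (Ideal.Quotient.mkₐ F M)⟩

open PrimeSpectrum in
theorem exists_ringHom_comp_eq_of_mem_range_comap {R S F : Type*} [CommRing R] [CommRing S]
    [Field F] [IsAlgClosed F] {i : R →+* S} (hi : i.FiniteType) {φ : R →+* F}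
    (hφ : comap φ ⊥ ∈ Set.range (comap i)) : ∃ ψ : S →+* F, ψ.comp i = φ := by
  algebraize [i, φ]
  let κ := (comap φ ⊥).asIdeal.ResidueField
  let κF : κ →ₐ[R] F := Ideal.ResidueField.liftₐ _ (Algebra.ofId R F) le_rfl fun x hx =>
    IsUnit.mk0 _ hx
  let : Algebra κ F := κF.toAlgebra
  have : IsScalarTower R κ F := IsScalarTower.of_algHom κF
  have : Nontrivial (κ ⊗[R] S) := (nontrivial_iff_mem_rangeComap _).2 hφ
  obtain ⟨ψ⟩ := nonempty_algHom_of_finiteType F (F ⊗[κ] (κ ⊗[R] S))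
  let incl : S →ₐ[R] F ⊗[κ] (κ ⊗[R] S) :=
    (Algebra.TensorProduct.includeRight.restrictScalars R).comp Algebra.TensorProduct.includeRight
  exact ⟨(ψ.restrictScalars R).comp incl, ((ψ.restrictScalars R).comp incl).comp_algebraMap⟩

section Place

variable {k F : Type*} [Field k] [Field F] {Γ : Subring (k × F)}

theorem inv_mem_of_maximal_isPartialHom (hΓ : Maximal IsPartialHom Γ) {x : k} {y : F}
    (hxy : (x, y) ∈ Γ) (hy : y ≠ 0) : (x⁻¹, y⁻¹) ∈ Γ := by
  let G := fractionGraph Γ.subtype fun a b hb => ⟨a, b, hb, mul_comm b a⟩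
  have hle : G ≤ Γ := hΓ.2 (isPartialHom_fractionGraph hΓ.1.fst_injective)
    fun q hq => apply_mem_fractionGraph (⟨q, hq⟩ : Γ)
  have hx : x ≠ 0 := by
    rintro rfl
    exact hy (hΓ.1 y hxy)
  exact hle ⟨⟨_, hxy⟩, 1, hy, by simp [hx, hy]⟩

theorem isLocalHom_of_maximal_isPartialHom (hΓ : Maximal IsPartialHom Γ)
    {φ : Γ.map (RingHom.fst k F) →+* F} (hφ : ∀ x : Γ.map (RingHom.fst k F), ((x : k), φ x) ∈ Γ) :
    IsLocalHom φ := by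
  refine ⟨fun x hx => ?_⟩
  have hinv := inv_mem_of_maximal_isPartialHom hΓ (hφ x) hx.ne_zero
  have hx0 : (x : k) ≠ 0 := by
    intro h0
    rw [show x = 0 from Subtype.ext h0, map_zero] at hx
    exact hx.ne_zero rfl
  exact .of_mul_eq_one ⟨_, Subring.mem_map.2 ⟨_, hinv, rfl⟩⟩ (Subtype.ext (mul_inv_cancel₀ hx0))

-- Any valuation ring dominating the domain `A` equals `A`: for `x` in it, the closed point of `A`
-- has a preimage in `Spec A[x]`, so the partial homomorphism extends to `A[x]`.
open IsLocalRing PrimeSpectrum in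
theorem exists_valuationSubring_eq_map_fst [IsAlgClosed F] (hΓ : Maximal IsPartialHom Γ) :
    ∃ O : ValuationSubring k, O.toSubring = Γ.map (RingHom.fst k F) := by
  let A := Γ.map (RingHom.fst k F)
  obtain ⟨φ, hφ⟩ : ∃ φ : A →+* F, ∀ x : A, ((x : k), φ x) ∈ Γ := hΓ.1.exists_hom
  have hφloc := isLocalHom_of_maximal_isPartialHom hΓ hφ
  have := RingHom.domain_isLocalRing φ
  obtain ⟨O, hAO, hloc⟩ := LocalSubring.exists_le_valuationSubring (.mk A)
  refine ⟨O, le_antisymm (fun x hx => ?_) hAO⟩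
  let S := Algebra.adjoin A {x}
  have hSO : S.toSubring ≤ O.toSubring := by
    rw [Algebra.adjoin_eq_ring_closure, Subring.closure_le]
    rintro _ (⟨a, rfl⟩ | rfl)
    exacts [hAO a.2, hx]
  have hmem : comap φ ⊥ ∈ Set.range (comap (algebraMap A S)) := by
    have hO : comap φ ⊥ = comap (Subring.inclusion hAO) (closedPoint O) := by
      rw [Subsingleton.elim ⊥ (closedPoint F)]
      exact (comap_closedPoint φ).trans (comap_closedPoint (Subring.inclusion hAO)).symm
    exact ⟨comap (Subring.inclusion hSO) (closedPoint O), hO.symm⟩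
  have hft : (algebraMap A S).FiniteType :=
    RingHom.finiteType_algebraMap.2 ((Subalgebra.fg_iff_finiteType _).1 ⟨{x}, by simp [S]⟩)
  obtain ⟨ψ, hψ⟩ := exists_ringHom_comp_eq_of_mem_range_comap hft hmem
  have hΓS : Γ ≤ ((S.val : S →+* k).prod ψ).range := by
    rintro ⟨a, b⟩ hab
    let a' : A := ⟨a, Subring.mem_map.2 ⟨_, hab, rfl⟩⟩
    refine ⟨algebraMap A S a', Prod.ext rfl ?_⟩
    exact (RingHom.congr_fun hψ a').trans (hΓ.1.eq_of_mem (hφ a') hab)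
  exact ⟨_, hΓ.2 (isPartialHom_range_prod Subtype.val_injective ψ) hΓS
    ⟨⟨x, Algebra.self_mem_adjoin_singleton _ _⟩, rfl⟩, rfl⟩

theorem exists_valuationSubring_hom [IsAlgClosed F] {R : Type*} [CommRing R] {i : R →+* k}
    (hi : Function.Injective i) (φ : R →+* F) :
    ∃ O : ValuationSubring k, i.range ≤ O.toSubring ∧ Nonempty (O →+* F) := by
  obtain ⟨Γ, hle, hΓ⟩ := exists_maximal_isPartialHom (isPartialHom_range_prod hi φ)
  obtain ⟨O, hO⟩ := exists_valuationSubring_eq_map_fst hΓ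
  obtain ⟨ψ, -⟩ := hΓ.1.exists_hom
  refine ⟨O, ?_, ⟨ψ.comp (Subring.inclusion hO.le)⟩⟩
  rintro _ ⟨r, rfl⟩
  rw [hO]
  exact ⟨_, hle ⟨r, rfl⟩, rfl⟩

open PrimeSpectrum in
theorem exists_forall_nonempty_ringHom (A : Type*) [CommRing A] [IsDomain A] [CharZero A]
    [Algebra.FiniteType ℤ A] :
    ∃ m : ℤ, m ≠ 0 ∧ ∀ (F : Type*) [Field F] [IsAlgClosed F], (m : F) ≠ 0 →
      Nonempty (A →+* F) := by
  have hA : Algebra.FiniteType ℤ A := ‹_›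
  have := Algebra.FinitePresentation.of_finiteType.1 hA
  have hopen : IsOpen (Set.range (comap (algebraMap ℤ A))) :=
    isOpenMap_comap_of_hasGoingDown_of_finitePresentation.isOpen_range
  have hbot : ⊥ ∈ Set.range (comap (algebraMap ℤ A)) := by
    refine ⟨⊥, PrimeSpectrum.ext ?_⟩
    exact (RingHom.injective_iff_ker_eq_bot _).1 (RingHom.injective_int (algebraMap ℤ A))
  obtain ⟨_, ⟨m, rfl⟩, hm, hsub⟩ :=
    isTopologicalBasis_basic_opens.exists_subset_of_mem_open hbot hopen
  refine ⟨m, by simpa using hm, fun F _ _ hmF => ?_⟩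
  obtain ⟨ψ, -⟩ := exists_ringHom_comp_eq_of_mem_range_comap
    (i := algebraMap ℤ A) (φ := Int.castRingHom F) (RingHom.finiteType_algebraMap.2 hA)
    (hsub (by simpa using hmF))
  exact ⟨ψ⟩

theorem exists_forall_exists_valuationSubring_hom [CharZero k] (s : Finset k) :
    ∃ m : ℤ, m ≠ 0 ∧ ∀ (F : Type*) [Field F] [IsAlgClosed F], (m : F) ≠ 0 →
      ∃ O : ValuationSubring k, (s : Set k) ⊆ O ∧ Nonempty (O →+* F) := by
  let A := Algebra.adjoin ℤ (s : Set k)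
  have : Algebra.FiniteType ℤ A := (Subalgebra.fg_iff_finiteType _).1 ⟨s, rfl⟩
  obtain ⟨m, hm0, hm⟩ := exists_forall_nonempty_ringHom A
  refine ⟨m, hm0, fun F _ _ hmF => ?_⟩
  obtain ⟨φ⟩ := hm F hmF
  obtain ⟨O, hO, hOF⟩ := exists_valuationSubring_hom (i := (A.val : A →+* k))
    Subtype.val_injective φ
  exact ⟨O, fun x hx => hO ⟨⟨x, Algebra.subset_adjoin hx⟩, rfl⟩, hOF⟩

end Place

/-! ### Specialization of skew fields of fractions -/

instance {R : Type*} [Ring R] [IsOreDomain R] : DivisionRing (SkewFrac R) := inferInstance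

section SkewFracHom

variable (F R : Type*) [CommRing F] [Ring R] [IsOreDomain R] [Algebra F R]

/-- The inclusion of an Ore domain into its skew field of fractions. -/
def skewFracHom : R →ₐ[F] SkewFrac R :=
  { OreLocalization.numeratorRingHom with commutes' := fun _ => rfl }

theorem skewFracHom_injective : Function.Injective (skewFracHom F R) :=
  OreLocalization.numeratorHom_inj fun _ hx => hx.1

variable {R} in
theorem exists_skewFracHom_mul_eq (q : SkewFrac R) :
    ∃ s a : R, s ≠ 0 ∧ skewFracHom F R s * q = skewFracHom F R a := by
  induction q using OreLocalization.ind with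
  | _ r s => exact ⟨s, r, nonZeroDivisors.coe_ne_zero s, OreLocalization.mul_cancel⟩

end SkewFracHom

namespace ZCompatibleFamily

section Coordinates

variable (K : ZCompatibleFamily.{u, v})

theorem fil_mono : Monotone K.fil := by
  intro i j hij
  rw [K.fil_eq, K.fil_eq]
  exact pow_le_pow_right₀ le_sup_left hij

instance (i : ℕ) : Module.Free ℤ (K.fil i) := K.fil_free i
instance (i : ℕ) : Module.Finite ℤ (K.fil i) := K.fil_finite i

instance : CharZero K.ring :=
  ⟨fun a b h => by exact_mod_cast @K.int_injective a b (by simpa using h)⟩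

/-- The homomorphism `R ⊗ A_ℤ → S ⊗ A_ℤ` induced by `R → S`. -/
def mapScalars {R S : Type*} [CommRing R] [CommRing S] (f : R →+* S) :
    R ⊗[ℤ] K.ring →+* S ⊗[ℤ] K.ring :=
  (Algebra.TensorProduct.map f.toIntAlgHom (AlgHom.id ℤ K.ring)).toRingHom

@[simp]
theorem mapScalars_tmul {R S : Type*} [CommRing R] [CommRing S] (f : R →+* S) (r : R)
    (a : K.ring) : K.mapScalars f (r ⊗ₜ a) = f r ⊗ₜ a := rfl

theorem mapScalars_injective {R S : Type*} [CommRing R] [CommRing S] {f : R →+* S}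
    (hf : Function.Injective f) : Function.Injective (K.mapScalars f) :=
  Module.Flat.rTensor_preserves_injective_linearMap (M := K.ring) f.toIntAlgHom.toLinearMap hf

/-- The element of `R ⊗ A_i^ℤ ⊆ R ⊗ A_ℤ` with given coordinates with respect to a basis of
`A_i^ℤ`. -/
def ofCoords (R : Type*) [CommRing R] (i : ℕ) :
    (Fin (Module.finrank ℤ (K.fil i)) → R) →ₗ[R] R ⊗[ℤ] K.ring :=
  Fintype.linearCombination R fun j => 1 ⊗ₜ (Module.finBasis ℤ (K.fil i) j : K.ring)

theorem mapScalars_ofCoords {R S : Type*} [CommRing R] [CommRing S] (f : R →+* S) {i : ℕ}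
    (c : Fin (Module.finrank ℤ (K.fil i)) → R) :
    K.mapScalars f (K.ofCoords R i c) = K.ofCoords S i (f ∘ c) := by
  simp [ofCoords, Fintype.linearCombination_apply, TensorProduct.smul_tmul']

theorem ofCoords_injective {F : Type u} [Field F] [IsAlgClosed F] (i : ℕ) :
    Function.Injective (K.ofCoords F i) := by
  have h := ((Module.finBasis ℤ (K.fil i)).baseChange F).linearIndependent.map' _
    (LinearMap.ker_eq_bot.2 (K.fil_baseChange F i))
  convert h.fintypeLinearCombination_injective
  ext j
  simp [ofCoords]

theorem range_ofCoords (R : Type*) [CommRing R] (i : ℕ) :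
    LinearMap.range (K.ofCoords R i) = (K.fil i).baseChange R := by
  have hspan : Submodule.span ℤ
      (Set.range fun j => (Module.finBasis ℤ (K.fil i) j : K.ring)) = K.fil i := by
    have h := congrArg (Submodule.map (K.fil i).subtype) (Module.finBasis ℤ (K.fil i)).span_eq
    rwa [Submodule.map_span, ← Set.range_comp, Submodule.map_top, Submodule.range_subtype] at h
  conv_rhs => rw [← hspan, Submodule.baseChange_span, ← Set.range_comp]
  exact Fintype.range_linearCombination R _

theorem exists_forall_mem_range_ofCoords {R : Type*} [CommRing R] (x : R ⊗[ℤ] K.ring) :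
    ∃ i₀, ∀ i ≥ i₀, x ∈ LinearMap.range (K.ofCoords R i) := by
  simp only [range_ofCoords]
  induction x using TensorProduct.induction_on with
  | zero => exact ⟨0, fun i _ => zero_mem _⟩
  | add x y hx hy =>
    obtain ⟨i₁, h₁⟩ := hx
    obtain ⟨i₂, h₂⟩ := hy
    exact ⟨max i₁ i₂, fun i hi => add_mem (h₁ i (le_of_max_le_left hi))
      (h₂ i (le_of_max_le_right hi))⟩
  | tmul r a =>
    have ha : a ∈ ⨆ i, K.fil i := K.fil_exhaustive ▸ Submodule.mem_top
    rw [Submodule.mem_iSup_of_directed _ K.fil_mono.directed_le] at ha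
    obtain ⟨i₀, hi₀⟩ := ha
    exact ⟨i₀, fun i hi => Submodule.tmul_mem_baseChange_of_mem _ (K.fil_mono hi hi₀)⟩

end Coordinates

end ZCompatibleFamily

theorem exists_mul_mem_of_ne_zero {k J : Type*} [Field k] (O : ValuationSubring k) [Finite J]
    {x : J → k} (hx : x ≠ 0) : ∃ r : k, (∀ j, r * x j ∈ O) ∧ ∃ j, r * x j = 1 := by
  obtain ⟨j₁, hj₁⟩ := Function.ne_iff.1 hx
  have : Nonempty J := ⟨j₁⟩
  obtain ⟨j₀, hj₀⟩ := Finite.exists_max fun j => O.valuation (x j)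
  have h0 : x j₀ ≠ 0 := by
    intro h
    have := hj₀ j₁
    rw [h, map_zero, le_zero_iff, map_eq_zero] at this
    exact hj₁ this
  refine ⟨(x j₀)⁻¹, fun j => ?_, j₀, inv_mul_cancel₀ h0⟩
  rw [← O.valuation_le_one_iff, map_mul, map_inv₀]
  exact inv_mul_le_one_of_le₀ (hj₀ j) zero_le

/-- The neighbourhood filter of the generic point of the Zariski–Riemann space of `k`: a property
of valuation subrings holds eventually if it holds for all those containing some finite subset
of `k`. -/
def genericFilter (k : Type*) [Field k] : Filter (ValuationSubring k) :=
  ⨅ x : k, Filter.principal {O | x ∈ O}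

theorem eventually_mem_genericFilter {k : Type*} [Field k] (x : k) :
    ∀ᶠ O in genericFilter k, x ∈ O :=
  Filter.mem_iInf_of_mem x (Filter.mem_principal_self _)

theorem exists_finset_of_eventually_genericFilter {k : Type*} [Field k]
    {p : ValuationSubring k → Prop} (h : ∀ᶠ O in genericFilter k, p O) :
    ∃ s : Finset k, ∀ O : ValuationSubring k, (s : Set k) ⊆ O → p O := by
  obtain ⟨s, hs, hsub⟩ := (Filter.hasBasis_iInf_principal_finite _).mem_iff.1 h
  refine ⟨hs.toFinset, fun O hO => hsub ?_⟩
  simpa [Set.subset_def] using hO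

namespace ZCompatibleFamily

variable (K : ZCompatibleFamily.{u, v}) {k F : Type u} [Field k] [Field F] [IsAlgClosed F]

theorem eventually_exists_lift {x : K.alg k} (hx : x ≠ 0) :
    ∀ᶠ O : ValuationSubring k in genericFilter k,
      ∀ (F : Type u) [Field F] [IsAlgClosed F] (φ : O →+* F),
      ∃ x' : O ⊗[ℤ] K.ring, K.mapScalars O.subtype x' = x ∧ K.mapScalars φ x' ≠ 0 := by
  obtain ⟨i, hi⟩ := K.exists_forall_mem_range_ofCoords x
  obtain ⟨c, rfl⟩ := hi i le_rfl
  obtain ⟨j, hj⟩ : ∃ j, c j ≠ 0 := Function.ne_iff.1 (ne_zero_of_map hx)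
  filter_upwards [Filter.eventually_all.2 fun j => eventually_mem_genericFilter (c j),
    eventually_mem_genericFilter (c j)⁻¹] with O hc hinv F _ _ φ
  let c' : Fin (Module.finrank ℤ (K.fil i)) → O := fun j => ⟨c j, hc j⟩
  refine ⟨K.ofCoords O i c', by rw [mapScalars_ofCoords]; rfl, ?_⟩
  rw [mapScalars_ofCoords, map_ne_zero_iff _ (K.ofCoords_injective i)]
  have hunit : IsUnit (c' j) :=
    .of_mul_eq_one ⟨(c j)⁻¹, hinv⟩ (Subtype.ext (mul_inv_cancel₀ hj))
  exact Function.ne_iff.2 ⟨j, (hunit.map φ).ne_zero⟩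

-- Gauss's lemma: divide by a coefficient of `x` or `y` of maximal valuation.
theorem exists_smul_lift_of_ne_zero (O : ValuationSubring k) (φ : O →+* F) {x y : K.alg k}
    (hy : y ≠ 0) :
    ∃ (r : k) (x' y' : O ⊗[ℤ] K.ring), K.mapScalars O.subtype x' = r • x ∧
      K.mapScalars O.subtype y' = r • y ∧ (K.mapScalars φ x' ≠ 0 ∨ K.mapScalars φ y' ≠ 0) := by
  obtain ⟨i₁, h₁⟩ := K.exists_forall_mem_range_ofCoords x
  obtain ⟨i₂, h₂⟩ := K.exists_forall_mem_range_ofCoords y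
  obtain ⟨c, rfl⟩ := h₁ _ (le_max_left i₁ i₂)
  obtain ⟨d, rfl⟩ := h₂ _ (le_max_right i₁ i₂)
  obtain ⟨j, hj⟩ : ∃ j, d j ≠ 0 := Function.ne_iff.1 (ne_zero_of_map hy)
  obtain ⟨r, hrO, j₀, hj₀⟩ := exists_mul_mem_of_ne_zero O (x := Sum.elim c d)
    (Function.ne_iff.2 ⟨.inr j, hj⟩)
  let c' : Fin (Module.finrank ℤ (K.fil (max i₁ i₂))) → O := fun j => ⟨r * c j, hrO (.inl j)⟩
  let d' : Fin (Module.finrank ℤ (K.fil (max i₁ i₂))) → O := fun j => ⟨r * d j, hrO (.inr j)⟩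
  refine ⟨r, K.ofCoords O _ c', K.ofCoords O _ d', ?_, ?_, ?_⟩
  · rw [mapScalars_ofCoords, ← map_smul]; rfl
  · rw [mapScalars_ofCoords, ← map_smul]; rfl
  · simp only [mapScalars_ofCoords, map_ne_zero_iff _ (K.ofCoords_injective _)]
    have hφ (z : O) (hz : (z : k) = 1) : φ z ≠ 0 := by
      rw [show z = 1 from Subtype.ext hz, map_one]
      exact one_ne_zero
    rcases j₀ with j | j
    · exact .inl (Function.ne_iff.2 ⟨j, hφ _ hj₀⟩)
    · exact .inr (Function.ne_iff.2 ⟨j, hφ _ hj₀⟩)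

variable [IsAlgClosed k]

theorem exists_mul_eq_mul_of_mapScalars_ne_zero (O : ValuationSubring k) (φ : O →+* F)
    (a b : O ⊗[ℤ] K.ring) (hb : K.mapScalars φ b ≠ 0) :
    ∃ c d : O ⊗[ℤ] K.ring, K.mapScalars φ d ≠ 0 ∧ d * a = c * b := by
  have hinj : Function.Injective (K.mapScalars O.subtype) :=
    K.mapScalars_injective Subtype.val_injective
  have hb' : K.mapScalars O.subtype b ≠ 0 := (map_ne_zero_iff _ hinj).2 (ne_zero_of_map hb)
  obtain ⟨c, d, hd, hcd⟩ := IsOreDomain.left_ore (K.mapScalars O.subtype a) _ hb'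
  obtain ⟨r, c', d', hc', hd', hcd'⟩ := K.exists_smul_lift_of_ne_zero O φ (x := c) hd
  have heq : d' * a = c' * b := hinj <| by
    rw [map_mul, map_mul, hc', hd', smul_mul_assoc, smul_mul_assoc, hcd]
  refine ⟨c', d', fun hd0 => ?_, heq⟩
  have hprod : K.mapScalars φ c' * K.mapScalars φ b = 0 := by
    rw [← map_mul, ← heq, map_mul, hd0, zero_mul]
  exact hcd'.elim (fun hc0 => hc0 ((mul_eq_zero.1 hprod).resolve_right hb)) fun h => h hd0

/-- The specialization from `Frac A_k` to `Frac A_F` given by a homomorphism from a valuation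
subring of `k` to `F`, as a partial homomorphism. -/
def spec (O : ValuationSubring k) (φ : O →+* F) :
    Subring (SkewFrac (K.alg k) × SkewFrac (K.alg F)) :=
  fractionGraph
    (((skewFracHom k (K.alg k) : _ →+* _).comp (K.mapScalars O.subtype)).prod
      ((skewFracHom F (K.alg F) : _ →+* _).comp (K.mapScalars φ)))
    fun a b hb => by
      obtain ⟨c, d, hd, hcd⟩ :=
        K.exists_mul_eq_mul_of_mapScalars_ne_zero O φ a b (ne_zero_of_map (f := skewFracHom F _) hb)
      exact ⟨c, d, (map_ne_zero_iff _ (skewFracHom_injective F _)).2 hd, hcd⟩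

variable {K} {O : ValuationSubring k} {φ : O →+* F}

theorem tmul_mem_spec (r : O) (a : K.ring) :
    (skewFracHom k (K.alg k) ((r : k) ⊗ₜ a), skewFracHom F (K.alg F) (φ r ⊗ₜ a)) ∈ K.spec O φ :=
  apply_mem_fractionGraph (r ⊗ₜ[ℤ] a)

theorem algebraMap_mem_spec (r : O) :
    (algebraMap k (SkewFrac (K.alg k)) r, algebraMap F (SkewFrac (K.alg F)) (φ r)) ∈
      K.spec O φ := by
  rw [← (skewFracHom k (K.alg k)).commutes, ← (skewFracHom F (K.alg F)).commutes]
  exact tmul_mem_spec r 1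

theorem isPartialHom_spec : IsPartialHom (K.spec O φ) :=
  isPartialHom_fractionGraph <| (skewFracHom_injective k (K.alg k)).comp <|
    K.mapScalars_injective Subtype.val_injective

theorem eventually_exists_ne_zero_mem_spec {q : SkewFrac (K.alg k)} (hq : q ≠ 0) :
    ∀ᶠ O : ValuationSubring k in genericFilter k,
      ∀ (F : Type u) [Field F] [IsAlgClosed F] (φ : O →+* F),
      ∃ q' ≠ 0, (q, q') ∈ K.spec O φ := by
  obtain ⟨s, a, hs, hsa⟩ := exists_skewFracHom_mul_eq k q
  have ha : a ≠ 0 := by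
    rintro rfl
    rw [map_zero, mul_eq_zero, or_iff_left hq] at hsa
    exact hs (skewFracHom_injective k _ (hsa.trans (map_zero _).symm))
  filter_upwards [K.eventually_exists_lift hs, K.eventually_exists_lift ha] with O hs ha F _ _ φ
  obtain ⟨s', rfl, hs'⟩ := hs F φ
  obtain ⟨a', rfl, ha'⟩ := ha F φ
  rw [← map_ne_zero_iff _ (skewFracHom_injective F (K.alg F))] at hs' ha'
  refine ⟨(skewFracHom F _ (K.mapScalars φ s'))⁻¹ * skewFracHom F _ (K.mapScalars φ a'),
    mul_ne_zero (inv_ne_zero hs') ha', s', a', hs', Prod.ext hsa ?_⟩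
  exact mul_inv_cancel_left₀ hs' _

theorem eventually_exists_mem_spec (q : SkewFrac (K.alg k)) :
    ∀ᶠ O : ValuationSubring k in genericFilter k,
      ∀ (F : Type u) [Field F] [IsAlgClosed F] (φ : O →+* F), ∃ q', (q, q') ∈ K.spec O φ := by
  rcases eq_or_ne q 0 with rfl | hq
  · exact .of_forall fun O F _ _ φ => ⟨0, zero_mem _⟩
  · filter_upwards [eventually_exists_ne_zero_mem_spec hq] with O hO F _ _ φ
    exact (hO F φ).imp fun _ h => h.2

end ZCompatibleFamily

/-! ### Growth of almost commutative algebras -/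

section Monomials

variable (F : Type*) {E ι : Type*} [Field F] [Ring E] [Algebra F E] (w : ι → E)

/-- The span of `1` and the generators `w i`; its powers filter the algebra generated by `w`. -/
def genSpan : Submodule F E := 1 ⊔ Submodule.span F (Set.range w)

/-- The commutators of the generators have filtration degree at most one, so that the associated
graded algebra is commutative. -/
def AlmostCommute : Prop := ∀ i j, w i * w j - w j * w i ∈ genSpan F w

/-- The monomial in the generators `w i` with exponents `α`, its factors being taken in some fixed
order. -/
def mon (α : ι →₀ ℕ) : E := (α.toMultiset.toList.map w).prod

/-- The span of the monomials whose exponents are smaller than `γ` in the degree-lexicographic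
order. -/
def lowerSpan [LinearOrder ι] (γ : ι →₀ ℕ) : Submodule F E :=
  Submodule.span F (mon w '' {α | toDegLex α < toDegLex γ})

variable {F w}

theorem one_le_genSpan : 1 ≤ genSpan F w := le_sup_left

theorem mem_genSpan (i : ι) : w i ∈ genSpan F w :=
  Submodule.mem_sup_right (Submodule.subset_span ⟨i, rfl⟩)

theorem prod_map_mem_genSpan_pow (L : List ι) : (L.map w).prod ∈ genSpan F w ^ L.length := by
  induction L with
  | nil => exact Submodule.one_le.1 le_rfl
  | cons i L ih =>
    rw [List.map_cons, List.prod_cons, List.length_cons, pow_succ']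
    exact Submodule.mul_mem_mul (mem_genSpan i) ih

theorem prod_map_sub_prod_map_mem_of_perm (hw : AlmostCommute F w) {L L' : List ι}
    (h : L.Perm L') {m : ℕ} (hm : L.length ≤ m + 1) :
    (L.map w).prod - (L'.map w).prod ∈ genSpan F w ^ m := by
  induction h generalizing m with
  | nil => simp
  | @cons i L L' h ih =>
    rw [List.length_cons, Nat.add_le_add_iff_right] at hm
    rw [List.map_cons, List.map_cons, List.prod_cons, List.prod_cons, ← mul_sub]
    cases m with
    | zero =>
      obtain rfl := List.eq_nil_of_length_eq_zero (Nat.le_zero.1 hm)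
      simp [h.nil_eq]
    | succ m =>
      rw [pow_succ']
      exact Submodule.mul_mem_mul (mem_genSpan i) (ih hm)
  | swap i j L =>
    have hsub : ((j :: i :: L).map w).prod - ((i :: j :: L).map w).prod =
        (w j * w i - w i * w j) * (L.map w).prod := by
      simp [sub_mul, mul_assoc]
    have hmem := Submodule.mul_mem_mul (hw j i) (prod_map_mem_genSpan_pow (F := F) (w := w) L)
    rw [← hsub, ← pow_succ'] at hmem
    exact pow_le_pow_right₀ one_le_genSpan (by simpa using hm) hmem
  | trans h₁ _ ih₁ ih₂ =>
    simpa using add_mem (ih₁ hm) (ih₂ (h₁.length_eq ▸ hm))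

@[simp]
theorem mon_zero : mon w 0 = 1 := by simp [mon]

@[simp]
theorem mon_single_one (i : ι) : mon w (Finsupp.single i 1) = w i := by simp [mon]

theorem mon_mul_mon_sub_mem (hw : AlmostCommute F w) {α β : ι →₀ ℕ} {m : ℕ}
    (hm : (α + β).degree ≤ m + 1) : mon w α * mon w β - mon w (α + β) ∈ genSpan F w ^ m := by
  have hperm : (α.toMultiset.toList ++ β.toMultiset.toList).Perm (α + β).toMultiset.toList := by
    rw [← Multiset.coe_eq_coe, ← Multiset.coe_add]
    simp
  have hlen : (α.toMultiset.toList ++ β.toMultiset.toList).length ≤ m + 1 := by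
    rw [hperm.length_eq, Multiset.length_toList, Finsupp.card_toMultiset]
    exact hm
  simpa [mon] using prod_map_sub_prod_map_mem_of_perm hw hperm hlen

theorem genSpan_pow_le_span_mon (hw : AlmostCommute F w) (m : ℕ) :
    genSpan F w ^ m ≤ Submodule.span F (mon w '' {α | α.degree ≤ m}) := by
  induction m with
  | zero =>
    rw [pow_zero, Submodule.one_le]
    exact Submodule.subset_span ⟨0, by simp, mon_zero⟩
  | succ m ih =>
    have hmono : Submodule.span F (mon w '' {α | α.degree ≤ m}) ≤
        Submodule.span F (mon w '' {α | α.degree ≤ m + 1}) :=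
      Submodule.span_mono (Set.image_mono fun α hα => Nat.le_succ_of_le hα)
    rw [pow_succ']
    refine (mul_le_mul_right ih _).trans ?_
    rw [genSpan, Submodule.sup_mul, one_mul, Submodule.span_mul_span]
    refine sup_le hmono (Submodule.span_le.2 ?_)
    rintro _ ⟨_, ⟨i, rfl⟩, _, ⟨α, hα, rfl⟩, rfl⟩
    have hdeg : (Finsupp.single i 1 + α).degree ≤ m + 1 := by
      rw [map_add, Finsupp.degree_single, add_comm]
      exact Nat.succ_le_succ hα
    have hsub := hmono (ih (mon_mul_mon_sub_mem hw hdeg))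
    rw [mon_single_one] at hsub
    simpa using add_mem hsub (Submodule.subset_span ⟨_, hdeg, rfl⟩)

section LowerSpan

variable [LinearOrder ι]

theorem mon_mem_lowerSpan {α γ : ι →₀ ℕ} (h : toDegLex α < toDegLex γ) :
    mon w α ∈ lowerSpan F w γ :=
  Submodule.subset_span ⟨α, h, rfl⟩

theorem lowerSpan_mono {α γ : ι →₀ ℕ} (h : toDegLex α ≤ toDegLex γ) :
    lowerSpan F w α ≤ lowerSpan F w γ :=
  Submodule.span_mono (Set.image_mono fun _ hβ => lt_of_lt_of_le hβ h)

theorem exists_mon_mem_lowerSpan_of_not_linearIndependent (h : ¬ LinearIndependent F (mon w)) :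
    ∃ γ, mon w γ ∈ lowerSpan F w γ := by
  rw [linearIndependent_iff] at h
  push Not at h
  obtain ⟨g, hg, hg0⟩ := h
  obtain ⟨γ, hγ, hmax⟩ := Finset.exists_max_image g.support toDegLex
    (Finsupp.support_nonempty_iff.2 hg0)
  refine ⟨γ, ?_⟩
  have hγ0 : g γ ≠ 0 := Finsupp.mem_support_iff.1 hγ
  rw [Finsupp.linearCombination_apply, Finsupp.sum, ← Finset.add_sum_erase _ _ hγ,
    add_eq_zero_iff_eq_neg] at hg
  rw [← inv_smul_smul₀ hγ0 (mon w γ), hg]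
  refine Submodule.smul_mem _ _ (neg_mem (sum_mem fun α hα => Submodule.smul_mem _ _ ?_))
  rw [Finset.mem_erase] at hα
  exact mon_mem_lowerSpan (lt_of_le_of_ne (hmax α hα.2) fun h => hα.1 (toDegLex_injective h))

theorem mon_mul_mon_sub_mem_lowerSpan (hw : AlmostCommute F w) (α β : ι →₀ ℕ) :
    mon w α * mon w β - mon w (α + β) ∈ lowerSpan F w (α + β) := by
  rcases hdeg : (α + β).degree with _ | m
  · obtain ⟨rfl, rfl⟩ := add_eq_zero.1 ((Finsupp.degree_eq_zero_iff _).1 hdeg)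
    simp
  · refine Submodule.span_mono (Set.image_mono fun δ hδ => ?_)
      (genSpan_pow_le_span_mon hw m (mon_mul_mon_sub_mem hw hdeg.le))
    exact Finsupp.DegLex.lt_iff.2 (.inl (hdeg ▸ Nat.lt_succ_of_le hδ))

theorem mon_add_mem_lowerSpan (hw : AlmostCommute F w) {γ : ι →₀ ℕ}
    (hγ : mon w γ ∈ lowerSpan F w γ) (δ : ι →₀ ℕ) : mon w (γ + δ) ∈ lowerSpan F w (γ + δ) := by
  have hmul : lowerSpan F w γ ≤ (lowerSpan F w (γ + δ)).comap (LinearMap.mulRight F (mon w δ)) := by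
    refine Submodule.span_le.2 ?_
    rintro _ ⟨β, hβ, rfl⟩
    have hlt : toDegLex (β + δ) < toDegLex (γ + δ) := by
      rw [toDegLex_add, toDegLex_add]
      exact add_lt_add_left hβ _
    simpa using add_mem (lowerSpan_mono hlt.le (mon_mul_mon_sub_mem_lowerSpan hw β δ))
      (mon_mem_lowerSpan hlt)
  have hγδ : mon w γ * mon w δ ∈ lowerSpan F w (γ + δ) := hmul hγ
  simpa using sub_mem hγδ (mon_mul_mon_sub_mem_lowerSpan hw γ δ)

theorem mon_mem_span_not_le [Finite ι] (hw : AlmostCommute F w) {γ : ι →₀ ℕ}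
    (hγ : mon w γ ∈ lowerSpan F w γ) (α : ι →₀ ℕ) :
    mon w α ∈ Submodule.span F (mon w '' {β | ¬ γ ≤ β ∧ β.degree ≤ α.degree}) := by
  have wf : WellFounded ((· < ·) : DegLex (ι →₀ ℕ) → DegLex (ι →₀ ℕ) → Prop) := wellFounded_lt
  induction α using WellFounded.induction (InvImage.wf toDegLex wf) with
  | _ α ih =>
  by_cases hα : γ ≤ α
  · obtain ⟨δ, rfl⟩ := exists_add_of_le hα
    refine Submodule.span_le.2 ?_ (mon_add_mem_lowerSpan hw hγ δ)
    rintro _ ⟨β, hβ, rfl⟩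
    refine Submodule.span_mono (Set.image_mono fun ε hε => ?_) (ih β hβ)
    exact ⟨hε.1, hε.2.trans (Finsupp.DegLex.monotone_degree hβ.le)⟩
  · exact Submodule.subset_span ⟨α, ⟨hα, le_rfl⟩, rfl⟩

end LowerSpan

end Monomials

section Counting

variable {ι : Type*} [Fintype ι]

theorem ncard_le_prod_card {T : Set (ι →₀ ℕ)} {t : ι → Finset ℕ}
    (h : ∀ α ∈ T, ∀ i, α i ∈ t i) : T.ncard ≤ ∏ i, (t i).card := by
  classical
  rw [← Fintype.card_piFinset, ← Set.ncard_coe_finset]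
  exact Set.ncard_le_ncard_of_injOn DFunLike.coe (fun α hα => Fintype.mem_piFinset.2 (h α hα))
    DFunLike.coe_injective.injOn

theorem ncard_degree_le_le (m : ℕ) :
    {α : ι →₀ ℕ | α.degree ≤ m}.ncard ≤ (m + 1) ^ Fintype.card ι := by
  classical
  refine (ncard_le_prod_card (t := fun _ => Finset.range (m + 1)) fun α hα i => ?_).trans_eq
    (by simp)
  exact Finset.mem_range.2 (Nat.lt_succ_of_le ((Finsupp.le_degree i α).trans hα))

theorem ncard_not_le_and_degree_le_le (γ : ι →₀ ℕ) (m : ℕ) :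
    {α : ι →₀ ℕ | ¬ γ ≤ α ∧ α.degree ≤ m}.ncard ≤
      γ.degree * (m + 1) ^ (Fintype.card ι - 1) := by
  classical
  have hcover : {α : ι →₀ ℕ | ¬ γ ≤ α ∧ α.degree ≤ m} =
      ⋃ i ∈ Finset.univ, {α : ι →₀ ℕ | α i < γ i ∧ α.degree ≤ m} := by
    ext α
    simp [Finsupp.le_def]
  have hcard (i : ι) : {α : ι →₀ ℕ | α i < γ i ∧ α.degree ≤ m}.ncard ≤
      γ i * (m + 1) ^ (Fintype.card ι - 1) := by
    refine (ncard_le_prod_card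
      (t := Function.update (fun _ => Finset.range (m + 1)) i (Finset.range (γ i)))
      fun α hα j => ?_).trans_eq ?_
    · rcases eq_or_ne j i with rfl | hj
      · simpa using hα.1
      · simpa [hj] using Nat.lt_succ_of_le ((Finsupp.le_degree j α).trans hα.2)
    · rw [← Finset.mul_prod_erase _ _ (Finset.mem_univ i),
        Finset.prod_congr rfl fun j hj => by rw [Function.update_of_ne (Finset.ne_of_mem_erase hj)]]
      simp [Finset.card_erase_of_mem]
  rw [hcover, Finsupp.degree_eq_sum, Finset.sum_mul]
  exact (Finset.univ.set_ncard_biUnion_le _).trans (Finset.sum_le_sum fun i _ => hcard i)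

end Counting

section Dimension

variable {F E ι : Type*} [Field F] [Ring E] [Algebra F E] {w : ι → E}

theorem finrank_span_image_le_ncard {κ : Type*} (f : κ → E) {T : Set κ} (hT : T.Finite) :
    Module.finrank F (Submodule.span F (f '' T)) ≤ T.ncard := by
  classical
  have := finrank_span_finset_le_card (R := F) (hT.toFinset.image f)
  rw [Finset.coe_image, hT.coe_toFinset] at this
  exact this.trans (Finset.card_image_le.trans_eq (Set.ncard_eq_toFinset_card T hT).symm)

theorem genSpan_fg [Finite ι] : (genSpan F w).FG := by
  rw [genSpan, Submodule.one_eq_span]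
  exact (Submodule.fg_span_singleton 1).sup (Submodule.fg_span (Set.finite_range w))

instance [Finite ι] (m : ℕ) : Module.Finite F (genSpan F w ^ m : Submodule F E) :=
  Module.Finite.iff_fg.2 (genSpan_fg.pow m)

variable [Fintype ι]

theorem finrank_genSpan_pow_le (hw : AlmostCommute F w) (m : ℕ) :
    Module.finrank F (genSpan F w ^ m : Submodule F E) ≤ (m + 1) ^ Fintype.card ι := by
  have hfin := Finsupp.finite_of_degree_le (σ := ι) m
  have := Module.Finite.span_of_finite F (hfin.image (mon w))
  exact (Submodule.finrank_mono (genSpan_pow_le_span_mon hw m)).trans <|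
    (finrank_span_image_le_ncard _ hfin).trans (ncard_degree_le_le m)

theorem exists_finrank_genSpan_pow_le_of_not_linearIndependent (hw : AlmostCommute F w)
    (h : ¬ LinearIndependent F (mon w)) :
    ∃ C, ∀ m, Module.finrank F (genSpan F w ^ m : Submodule F E) ≤
      C * (m + 1) ^ (Fintype.card ι - 1) := by
  let : LinearOrder ι := LinearOrder.lift' (Fintype.equivFin ι) (Fintype.equivFin ι).injective
  obtain ⟨γ, hγ⟩ := exists_mon_mem_lowerSpan_of_not_linearIndependent h
  refine ⟨γ.degree, fun m => ?_⟩
  have hfin : {β : ι →₀ ℕ | ¬ γ ≤ β ∧ β.degree ≤ m}.Finite :=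
    (Finsupp.finite_of_degree_le m).subset fun _ hβ => hβ.2
  have := Module.Finite.span_of_finite F (hfin.image (mon w))
  have hle : genSpan F w ^ m ≤ Submodule.span F (mon w '' {β | ¬ γ ≤ β ∧ β.degree ≤ m}) := by
    refine (genSpan_pow_le_span_mon hw m).trans (Submodule.span_le.2 ?_)
    rintro _ ⟨α, hα, rfl⟩
    refine Submodule.span_mono (Set.image_mono fun β hβ => ?_) (mon_mem_span_not_le hw hγ α)
    exact ⟨hβ.1, hβ.2.trans hα⟩
  exact (Submodule.finrank_mono hle).trans <|
    (finrank_span_image_le_ncard _ hfin).trans (ncard_not_le_and_degree_le_le γ m)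

end Dimension

/-! ### Gelfand–Kirillov dimension and fractions -/

theorem one_sup_span_pow_le_adjoin {R A : Type*} [CommRing R] [Ring A] [Algebra R A] (s : Set A)
    (m : ℕ) : (1 ⊔ Submodule.span R s) ^ m ≤ Subalgebra.toSubmodule (Algebra.adjoin R s) := by
  have hle : 1 ⊔ Submodule.span R s ≤ Subalgebra.toSubmodule (Algebra.adjoin R s) :=
    sup_le (Submodule.one_le.2 (one_mem (Algebra.adjoin R s)))
      (Submodule.span_le.2 Algebra.subset_adjoin)
  induction m with
  | zero => exact Submodule.one_le.2 (one_mem (Algebra.adjoin R s))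
  | succ m ih => exact (mul_le_mul' ih hle).trans (Subalgebra.isIdempotentElem_toSubmodule _).le

section Adjoin

variable {F E ι : Type*} [Field F] [Ring E] [Algebra F E] {w : ι → E}

theorem exists_mem_genSpan_pow {x : E} (hx : x ∈ Algebra.adjoin F (Set.range w)) :
    ∃ m, x ∈ genSpan F w ^ m := by
  have hmono : Monotone (genSpan F w ^ ·) := pow_right_mono₀ one_le_genSpan
  induction hx using Algebra.adjoin_induction with
  | mem x hx =>
    obtain ⟨i, rfl⟩ := hx
    exact ⟨1, by simpa using mem_genSpan i⟩
  | algebraMap r => exact ⟨0, by simp⟩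
  | add x y _ _ hx hy =>
    obtain ⟨m, hm⟩ := hx
    obtain ⟨n, hn⟩ := hy
    exact ⟨max m n, add_mem (hmono (le_max_left m n) hm) (hmono (le_max_right m n) hn)⟩
  | mul x y _ _ hx hy =>
    obtain ⟨m, hm⟩ := hx
    obtain ⟨n, hn⟩ := hy
    exact ⟨m + n, pow_add (genSpan F w) m n ▸ Submodule.mul_mem_mul hm hn⟩

theorem exists_forall_mem_genSpan_pow (s : Finset E)
    (hs : (s : Set E) ⊆ Algebra.adjoin F (Set.range w)) :
    ∃ m, (s : Set E) ⊆ (genSpan F w ^ m : Submodule F E) := by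
  choose! f hf using fun x (hx : x ∈ s) => exists_mem_genSpan_pow (hs hx)
  exact ⟨s.sup f, fun x hx => pow_le_pow_right₀ one_le_genSpan (Finset.le_sup hx) (hf x hx)⟩

theorem adjoin_le_span_mon (hw : AlmostCommute F w) :
    Subalgebra.toSubmodule (Algebra.adjoin F (Set.range w)) ≤
      Submodule.span F (Set.range (mon w)) := by
  intro x hx
  obtain ⟨m, hm⟩ := exists_mem_genSpan_pow hx
  exact Submodule.span_mono (Set.image_subset_range _ _) (genSpan_pow_le_span_mon hw m hm)

theorem limsup_log_div_log_le {a : ℕ → ℕ} {C d : ℕ} (h : ∀ n, 1 ≤ n → a n ≤ C * n ^ d) :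
    Filter.limsup (fun n : ℕ => ((Real.log (a n) / Real.log n : ℝ) : EReal)) Filter.atTop ≤
      (d : EReal) := by
  have hlim : Filter.Tendsto (fun n : ℕ => ((Real.log (C + 1) / Real.log n + d : ℝ) : EReal))
      Filter.atTop (nhds ((d : ℝ) : EReal)) := by
    refine (continuous_coe_real_ereal.tendsto _).comp ?_
    have h1 : Filter.Tendsto (fun n : ℕ => Real.log (C + 1) / Real.log n) Filter.atTop (nhds 0) :=
      Filter.Tendsto.div_atTop tendsto_const_nhds
        (Real.tendsto_log_atTop.comp tendsto_natCast_atTop_atTop)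
    simpa using h1.add_const (d : ℝ)
  have hle : (fun n : ℕ => ((Real.log (a n) / Real.log n : ℝ) : EReal)) ≤ᶠ[Filter.atTop]
      fun n : ℕ => ((Real.log (C + 1) / Real.log n + d : ℝ) : EReal) := by
    filter_upwards [Filter.eventually_ge_atTop 2] with n hn
    have hn1 : (1 : ℝ) < n := by exact_mod_cast hn
    have hlog : 0 < Real.log n := Real.log_pos hn1
    have hpow : (1 : ℝ) ≤ (n : ℝ) ^ d := one_le_pow₀ hn1.le
    have han : (a n : ℝ) ≤ C * (n : ℝ) ^ d := by exact_mod_cast h n (by omega)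
    rw [EReal.coe_le_coe_iff, div_add' _ _ _ hlog.ne']
    refine div_le_div_of_nonneg_right ?_ hlog.le
    rw [← Real.log_pow, ← Real.log_mul (by positivity) (by positivity)]
    -- `log 0 = 0` is bounded by the right-hand side as well.
    rcases Nat.eq_zero_or_pos (a n) with h0 | h0
    · rw [h0, Nat.cast_zero, Real.log_zero]
      exact Real.log_nonneg (one_le_mul_of_one_le_of_one_le (by simp) hpow)
    · exact Real.log_le_log (by exact_mod_cast h0) (by linarith)
  exact (Filter.limsup_le_limsup hle).trans_eq hlim.limsup_eq

theorem gkDim_le_of_finrank_genSpan_pow_le [Finite ι] {C d : ℕ}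
    (h : ∀ m, Module.finrank F (genSpan F w ^ m : Submodule F E) ≤ C * (m + 1) ^ d)
    {S : Subalgebra F E} (hS : S ≤ Algebra.adjoin F (Set.range w)) : gkDim F S ≤ (d : EReal) := by
  refine iSup₂_le fun W hW => ?_
  obtain ⟨s, hs⟩ := hW.map S.val.toLinearMap
  have hsS : (s : Set E) ⊆ S := by
    intro x hx
    obtain ⟨y, -, rfl⟩ : x ∈ W.map S.val.toLinearMap := hs ▸ Submodule.subset_span hx
    exact y.2
  obtain ⟨e, he⟩ := exists_forall_mem_genSpan_pow s (hsS.trans hS)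
  refine limsup_log_div_log_le (C := C * (e + 1) ^ d) fun n hn => ?_
  have hmap : ((1 ⊔ W) ^ n).map S.val.toLinearMap ≤ genSpan F w ^ (e * n) := by
    rw [Submodule.map_pow, pow_mul, Submodule.map_sup, Submodule.map_one, ← hs]
    exact pow_le_pow_left' (sup_le (one_le_pow₀ one_le_genSpan) (Submodule.span_le.2 he)) n
  calc Module.finrank F ((1 ⊔ W) ^ n : Submodule F S)
      = Module.finrank F (((1 ⊔ W) ^ n).map S.val.toLinearMap) :=
        (Submodule.equivMapOfInjective S.val.toLinearMap Subtype.val_injective _).finrank_eq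
    _ ≤ Module.finrank F (genSpan F w ^ (e * n) : Submodule F E) := Submodule.finrank_mono hmap
    _ ≤ C * (e * n + 1) ^ d := h _
    _ ≤ C * (e + 1) ^ d * n ^ d := by
      rw [mul_assoc, ← mul_pow]
      gcongr
      linarith

end Adjoin

section Ore

variable {F E ι : Type*} [Field F] [DivisionRing E] [Algebra F E] {w : ι → E}

theorem exists_pow_lt_two_pow (e d : ℕ) : ∃ m : ℕ, (e * m + 1) ^ d < 2 ^ m := by
  have h1 := tendsto_pow_const_div_const_pow_of_one_lt d (r := 2) one_lt_two
  have hpos : (0 : ℝ) < 1 / (e + 1) ^ d := by positivity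
  obtain ⟨m, hm, hm1⟩ := ((h1.eventually_lt_const hpos).and
    (Filter.eventually_ge_atTop 1)).exists
  refine ⟨m, ?_⟩
  rw [div_lt_div_iff₀ (by positivity) (by positivity), one_mul, ← mul_pow] at hm
  have : (m * (e + 1)) ^ d < 2 ^ m := by exact_mod_cast hm
  refine lt_of_le_of_lt (Nat.pow_le_pow_left ?_ d) this
  nlinarith

/-- The left Ore condition for a subalgebra of a skew field. -/
def LeftOre (B : Subalgebra F E) : Prop :=
  ∀ a ∈ B, ∀ b ∈ B, b ≠ 0 → ∃ c ∈ B, ∃ d ∈ B, d ≠ 0 ∧ d * a = c * b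

-- Failure of the Ore condition makes `(d, c) ↦ d * a - c * b` injective.
theorem two_mul_finrank_le_of_forall_mul_ne {U V : Submodule F E} [Module.Finite F V] {a b : E}
    (hb0 : b ≠ 0) (hne : ∀ c ∈ U, ∀ d ∈ U, d ≠ 0 → d * a ≠ c * b)
    (ha : ∀ d ∈ U, d * a ∈ V) (hb : ∀ c ∈ U, c * b ∈ V) :
    2 * Module.finrank F U ≤ Module.finrank F V := by
  let f : U × U →ₗ[F] V := ((LinearMap.mulRight F a).restrict ha).coprod
    (-((LinearMap.mulRight F b).restrict hb))
  have hf : Function.Injective f := by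
    rw [injective_iff_map_eq_zero]
    rintro ⟨⟨d, hd⟩, ⟨c, hc⟩⟩ h0
    have hdc : d * a = c * b := by
      have h : d * a + -(c * b) = 0 := congrArg Subtype.val h0
      rwa [← sub_eq_add_neg, sub_eq_zero] at h
    obtain rfl : d = 0 := by
      by_contra hd0
      exact hne c hc d hd hd0 hdc
    obtain rfl : c = 0 := by simpa [hb0, eq_comm] using hdc
    rfl
  have : Module.Finite F U :=
    Module.Finite.of_injective (f ∘ₗ LinearMap.inl F U U) (hf.comp LinearMap.inl_injective)
  rw [two_mul, ← Module.finrank_prod]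
  exact LinearMap.finrank_le_finrank_of_injective hf

theorem leftOre_adjoin [Finite ι] (hw : AlmostCommute F w) :
    LeftOre (Algebra.adjoin F (Set.range w)) := by
  classical
  intro a ha b hb hb0
  by_contra! hne
  obtain ⟨e, he⟩ := exists_forall_mem_genSpan_pow (F := F) (w := w) {a, b}
    (by simp [Set.insert_subset_iff, ha, hb])
  rw [Finset.coe_pair, Set.pair_subset_iff] at he
  have hmul {x y : E} {m : ℕ} (hx : x ∈ genSpan F w ^ (e * m)) (hy : y ∈ genSpan F w ^ e) :
      x * y ∈ genSpan F w ^ (e * (m + 1)) := by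
    rw [mul_add_one, pow_add]
    exact Submodule.mul_mem_mul hx hy
  have hpow (m : ℕ) : 2 ^ m ≤ Module.finrank F (genSpan F w ^ (e * m) : Submodule F E) := by
    induction m with
    | zero =>
      rw [pow_zero, Nat.one_le_iff_ne_zero, ne_eq, Submodule.finrank_eq_zero, mul_zero, pow_zero]
      exact one_ne_zero
    | succ m ih =>
      rw [pow_succ']
      refine (Nat.mul_le_mul_left 2 ih).trans (two_mul_finrank_le_of_forall_mul_ne hb0 ?_
        (fun d hd => hmul hd he.1) fun c hc => hmul hc he.2)
      exact fun c hc d hd =>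
        hne c (one_sup_span_pow_le_adjoin _ _ hc) d (one_sup_span_pow_le_adjoin _ _ hd)
  cases nonempty_fintype ι
  obtain ⟨m, hm⟩ := exists_pow_lt_two_pow e (Fintype.card ι)
  exact absurd ((hpow m).trans (finrank_genSpan_pow_le hw _)) hm.not_ge

end Ore

section Fractions

variable {F E ι : Type*} [Field F] [DivisionRing E] [Algebra F E] {w : ι → E}
  {B : Subalgebra F E}

/-- The subring of left fractions `b⁻¹ c` of a subalgebra with the left Ore condition. -/
def fractions (hB : LeftOre B) : Subring E :=
  (fractionGraph ((B.val : B →+* E).prod (B.val : B →+* E)) fun a b hb => by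
      obtain ⟨c, hc, d, hd, hd0, h⟩ := hB a a.2 b b.2 hb
      exact ⟨⟨c, hc⟩, ⟨d, hd⟩, hd0, Subtype.ext h⟩).comap
    ((RingHom.id E).prod (RingHom.id E))

variable {hB : LeftOre B}

theorem mem_fractions {q : E} : q ∈ fractions hB ↔ ∃ b ∈ B, b ≠ 0 ∧ b * q ∈ B := by
  constructor
  · rintro ⟨b, c, hb, h⟩
    have hbq : (b : E) * q = c := congrArg Prod.fst h
    exact ⟨b, b.2, hb, hbq ▸ c.2⟩
  · rintro ⟨b, hb, hb0, h⟩
    exact ⟨⟨b, hb⟩, ⟨b * q, h⟩, hb0, rfl⟩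

theorem mem_fractions_of_mem {q : E} (hq : q ∈ B) : q ∈ fractions hB :=
  mem_fractions.2 ⟨1, one_mem _, one_ne_zero, by rwa [one_mul]⟩

theorem inv_mem_fractions {q : E} (hq : q ∈ fractions hB) : q⁻¹ ∈ fractions hB := by
  rcases eq_or_ne q 0 with rfl | hq0
  · rwa [inv_zero]
  obtain ⟨b, hb, hb0, h⟩ := mem_fractions.1 hq
  exact mem_fractions.2 ⟨b * q, h, mul_ne_zero hb0 hq0, by rwa [mul_inv_cancel_right₀ hq0]⟩

theorem exists_common_denominator (hB : LeftOre B) (s : Finset E)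
    (hs : ∀ q ∈ s, q ∈ fractions hB) : ∃ b ∈ B, b ≠ 0 ∧ ∀ q ∈ s, b * q ∈ B := by
  classical
  induction s using Finset.induction_on with
  | empty => exact ⟨1, one_mem _, one_ne_zero, by simp⟩
  | insert q s _ ih =>
    obtain ⟨b, hb, hb0, h⟩ := ih fun q hq => hs q (Finset.mem_insert_of_mem hq)
    obtain ⟨b', hb', hb'0, h'⟩ := mem_fractions.1 (hs q (Finset.mem_insert_self _ _))
    obtain ⟨c, hc, d, hd, hd0, hcd⟩ := hB b hb b' hb' hb'0
    refine ⟨d * b, mul_mem hd hb, mul_ne_zero hd0 hb0, fun r hr => ?_⟩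
    rcases Finset.mem_insert.1 hr with rfl | hr
    · rw [hcd, mul_assoc]
      exact mul_mem hc h'
    · rw [mul_assoc]
      exact mul_mem hd (h r hr)

theorem tdeg_le_of_forall_le_gkDim_le (htop : fractions hB = ⊤) {d : EReal}
    (h : ∀ S ≤ B, gkDim F S ≤ d) : tdeg F E ≤ d := by
  refine iSup₂_le fun V hV => ?_
  obtain ⟨s, rfl⟩ := hV
  obtain ⟨b, -, hb0, hb⟩ := exists_common_denominator hB s fun q _ => htop ▸ Subring.mem_top q
  refine iInf₂_le_of_le b (mem_nonZeroDivisors_of_ne_zero hb0) (h _ (Algebra.adjoin_le ?_))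
  have hle : Submodule.span F (s : Set E) ≤
      (Subalgebra.toSubmodule B).comap (LinearMap.mulLeft F b) := Submodule.span_le.2 hb
  rintro _ ⟨v, hv, rfl⟩
  exact hle hv

theorem linearIndependent_mon_of_tdeg_eq_card [Fintype ι] (hw : AlmostCommute F w)
    (htop : fractions (leftOre_adjoin hw) = ⊤) (ht : tdeg F E = (Fintype.card ι : EReal)) :
    LinearIndependent F (mon w) := by
  rcases isEmpty_or_nonempty ι with _ | _
  · rw [linearIndependent_unique_iff, Subsingleton.elim default 0, mon_zero]
    exact one_ne_zero
  by_contra h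
  obtain ⟨C, hC⟩ := exists_finrank_genSpan_pow_le_of_not_linearIndependent hw h
  have hle := tdeg_le_of_forall_le_gkDim_le htop fun _ => gkDim_le_of_finrank_genSpan_pow_le hC
  rw [ht, Nat.cast_le] at hle
  have := Fintype.card_pos (α := ι)
  omega

end Fractions

/-! ### Weyl systems -/

/-- The index set of the generators `x_i`, `y_i` and `t_j` of a Weyl field. -/
abbrev WeylIndex (n l : ℕ) : Type := (Fin n ⊕ Fin n) ⊕ Fin l

/-- The commutators `[a, b]` of the generators `x_i`, `y_i` and `t_j` of a Weyl field. -/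
def weylForm {n l : ℕ} : WeylIndex n l → WeylIndex n l → ℤ
  | .inl (.inl i), .inl (.inr j) => if j = i then -1 else 0
  | .inl (.inr i), .inl (.inl j) => if i = j then 1 else 0
  | _, _ => 0

/-- The family `w` satisfies the commutation relations of the generators of a Weyl field. -/
def IsWeylSystem {n l : ℕ} {E : Type*} [Ring E] (w : WeylIndex n l → E) : Prop :=
  ∀ a b, w a * w b - w b * w a = weylForm a b

namespace IsWeylSystem

variable {n l : ℕ} {E E' : Type*} [Ring E] [Ring E'] {w : WeylIndex n l → E}

theorem map (hw : IsWeylSystem w) (f : E →+* E') : IsWeylSystem (f ∘ w) := fun a b => by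
  simpa using congrArg f (hw a b)

theorem of_map {f : E →+* E'} (hf : Function.Injective f) (hw : IsWeylSystem (f ∘ w)) :
    IsWeylSystem w := fun a b => hf (by simpa using hw a b)

theorem commute (hw : IsWeylSystem w) {a b : WeylIndex n l} (h : weylForm a b = 0) :
    Commute (w a) (w b) :=
  sub_eq_zero.1 (by simpa [h] using hw a b)

theorem almostCommute (hw : IsWeylSystem w) (F : Type*) [Field F] [Algebra F E] :
    AlmostCommute F w := fun a b => by
  rw [hw a b]
  refine one_le_genSpan ⟨weylForm a b, ?_⟩
  simp [Algebra.smul_def]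

end IsWeylSystem

section WeylGen

variable (k : Type u) [Field k] (n l : ℕ)

/-- The generators `x_i`, `y_i` and `t_j` of `A_n(k(t_1, …, t_l))`. -/
def weylGen : WeylIndex n l → WeylAlgebra (RatFun k l) n
  | .inl a => RingQuot.mkAlgHom (RatFun k l) (WeylRel (RatFun k l) n) (FreeAlgebra.ι _ a)
  | .inr j => algebraMap (RatFun k l) _ (algebraMap (MvPolynomial (Fin l) k) _ (MvPolynomial.X j))

theorem isWeylSystem_weylGen : IsWeylSystem (weylGen k n l) := by
  have hyx (i j : Fin n) : weylGen k n l (.inl (.inr i)) * weylGen k n l (.inl (.inl j)) -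
      weylGen k n l (.inl (.inl j)) * weylGen k n l (.inl (.inr i)) = if i = j then 1 else 0 := by
    have h := RingQuot.mkAlgHom_rel (RatFun k l) (WeylRel.y_x (K := RatFun k l) i j)
    rw [map_mul, map_add, map_mul, apply_ite (RingQuot.mkAlgHom _ _), map_one, map_zero] at h
    exact sub_eq_of_eq_add' h
  have hcomm {a b : WeylIndex n l} (h : Commute (weylGen k n l a) (weylGen k n l b))
      (h0 : weylForm a b = 0) : weylGen k n l a * weylGen k n l b -
        weylGen k n l b * weylGen k n l a = weylForm a b := by
    rw [h0, Int.cast_zero, sub_eq_zero, h.eq]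
  rintro ((i | i) | i) ((j | j) | j)
  · have h := RingQuot.mkAlgHom_rel (RatFun k l) (WeylRel.x_comm (K := RatFun k l) i j)
    rw [map_mul, map_mul] at h
    exact hcomm h rfl
  · rw [← neg_sub, hyx]
    split_ifs with h <;> simp [weylForm, h]
  · exact hcomm (Algebra.commutes _ _).symm rfl
  · rw [hyx]
    split_ifs with h <;> simp [weylForm, h]
  · have h := RingQuot.mkAlgHom_rel (RatFun k l) (WeylRel.y_comm (K := RatFun k l) i j)
    rw [map_mul, map_mul] at h
    exact hcomm h rfl
  · exact hcomm (Algebra.commutes _ _).symm rfl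
  all_goals exact hcomm (Algebra.commutes _ _) rfl

variable {k n l}

theorem algebraMap_mem_adjoin_weylGen (h : MvPolynomial (Fin l) k) :
    algebraMap (RatFun k l) (WeylAlgebra (RatFun k l) n) (algebraMap _ _ h) ∈
      Algebra.adjoin k (Set.range (weylGen k n l)) := by
  let g : MvPolynomial (Fin l) k →ₐ[k] WeylAlgebra (RatFun k l) n :=
    (IsScalarTower.toAlgHom k (RatFun k l) _).comp (IsScalarTower.toAlgHom k _ (RatFun k l))
  have hg : (⊤ : Subalgebra k (MvPolynomial (Fin l) k)) ≤
      (Algebra.adjoin k (Set.range (weylGen k n l))).comap g := by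
    rw [← MvPolynomial.adjoin_range_X, Algebra.adjoin_le_iff]
    rintro _ ⟨j, rfl⟩
    exact Algebra.subset_adjoin ⟨.inr j, rfl⟩
  exact hg (Algebra.mem_top (x := h))

theorem algebraMap_smul_mem_adjoin_weylGen (h : MvPolynomial (Fin l) k)
    {z : WeylAlgebra (RatFun k l) n} (hz : z ∈ Algebra.adjoin k (Set.range (weylGen k n l))) :
    algebraMap _ (RatFun k l) h • z ∈ Algebra.adjoin k (Set.range (weylGen k n l)) := by
  rw [Algebra.smul_def]
  exact mul_mem (algebraMap_mem_adjoin_weylGen h) hz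

theorem exists_smul_mem_adjoin_weylGen (z : WeylAlgebra (RatFun k l) n) :
    ∃ h : MvPolynomial (Fin l) k, h ≠ 0 ∧
      algebraMap _ (RatFun k l) h • z ∈ Algebra.adjoin k (Set.range (weylGen k n l)) := by
  obtain ⟨z, rfl⟩ := RingQuot.mkAlgHom_surjective (RatFun k l) (WeylRel (RatFun k l) n) z
  induction z using FreeAlgebra.induction with
  | grade0 r =>
    obtain ⟨a, s, hs, rfl⟩ := IsFractionRing.div_surjective (A := MvPolynomial (Fin l) k) r
    refine ⟨s, nonZeroDivisors.ne_zero hs, ?_⟩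
    have hs0 : algebraMap _ (RatFun k l) s ≠ 0 :=
      IsFractionRing.to_map_ne_zero_of_mem_nonZeroDivisors hs
    rw [AlgHom.commutes, Algebra.smul_def, ← map_mul, mul_div_cancel₀ _ hs0]
    exact algebraMap_mem_adjoin_weylGen a
  | grade1 a =>
    refine ⟨1, one_ne_zero, ?_⟩
    rw [map_one, one_smul]
    exact Algebra.subset_adjoin ⟨.inl a, rfl⟩
  | mul a b ha hb =>
    obtain ⟨p, hp, ha⟩ := ha
    obtain ⟨q, hq, hb⟩ := hb
    refine ⟨p * q, mul_ne_zero hp hq, ?_⟩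
    rw [map_mul, map_mul, ← smul_mul_smul_comm]
    exact mul_mem ha hb
  | add a b ha hb =>
    obtain ⟨p, hp, ha⟩ := ha
    obtain ⟨q, hq, hb⟩ := hb
    refine ⟨p * q, mul_ne_zero hp hq, ?_⟩
    rw [map_add, smul_add, map_mul]
    refine add_mem ?_ ?_
    · rw [mul_comm, mul_smul]
      exact algebraMap_smul_mem_adjoin_weylGen q ha
    · rw [mul_smul]
      exact algebraMap_smul_mem_adjoin_weylGen p hb

theorem exists_mul_mem_adjoin_weylGen {D : Type*} [DivisionRing D] [Algebra k D]
    {f : WeylAlgebra (RatFun k l) n →ₐ[k] D} (hf : IsSkewFractionMap f.toRingHom) (q : D) :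
    ∃ b ∈ Algebra.adjoin k (Set.range (f ∘ weylGen k n l)), b ≠ 0 ∧
      b * q ∈ Algebra.adjoin k (Set.range (f ∘ weylGen k n l)) := by
  obtain ⟨a, s, hs, rfl⟩ := hf.2 q
  obtain ⟨p, hp, hpa⟩ := exists_smul_mem_adjoin_weylGen a
  obtain ⟨r, hr, hrs⟩ := exists_smul_mem_adjoin_weylGen s
  let e := algebraMap (MvPolynomial (Fin l) k) (RatFun k l)
  have he {h : MvPolynomial (Fin l) k} (hh : h ≠ 0) : e h ≠ 0 :=
    (map_ne_zero_iff _ (IsFractionRing.injective _ _)).2 hh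
  have hfs : f s ≠ 0 := (map_ne_zero_iff f hf.1).2 hs
  have hmul : f (e r • e p • s) * ((f s)⁻¹ * f a) = f (e r • e p • a) := by
    simp only [Algebra.smul_def, map_mul, mul_assoc, mul_inv_cancel_left₀ hfs]
  rw [Set.range_comp, ← AlgHom.map_adjoin]
  refine ⟨f (e r • e p • s), ⟨_, ?_, rfl⟩,
    (map_ne_zero_iff f hf.1).2 (smul_ne_zero (he hr) (smul_ne_zero (he hp) hs)), ?_⟩
  · rw [smul_comm]
    exact algebraMap_smul_mem_adjoin_weylGen p hrs
  · exact hmul ▸ ⟨_, algebraMap_smul_mem_adjoin_weylGen r hpa, rfl⟩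

end WeylGen

section Monomials

variable {F U E ι : Type*} [Field F] [Ring U] [Algebra F U] [Ring E] [Algebra F E]

theorem map_mon (f : U →ₐ[F] E) (w : ι → U) (α : ι →₀ ℕ) : f (mon w α) = mon (f ∘ w) α := by
  simp [mon, map_list_prod]

theorem disjoint_adjoin_ker_of_linearIndependent_mon (f : U →ₐ[F] E) {w : ι → U}
    (hw : AlmostCommute F w) (hli : LinearIndependent F (mon (f ∘ w))) :
    Disjoint (Subalgebra.toSubmodule (Algebra.adjoin F (Set.range w)))
      (LinearMap.ker f.toLinearMap) := by
  have hli' : LinearIndependent F (f.toLinearMap ∘ mon w) := by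
    rwa [show f.toLinearMap ∘ mon w = mon (f ∘ w) from funext (map_mon f w)]
  exact (Submodule.range_ker_disjoint hli').mono_left (adjoin_le_span_mon hw)

theorem mon_comp {κ : Type*} {w : ι → E} {g : κ → ι}
    (hcomm : ∀ i j, Commute (w (g i)) (w (g j))) (β : κ →₀ ℕ) :
    mon (w ∘ g) β = mon w (β.mapDomain g) := by
  have hperm : (β.toMultiset.toList.map g).Perm (β.mapDomain g).toMultiset.toList := by
    rw [← Multiset.coe_eq_coe, ← Multiset.map_coe, Multiset.coe_toList, Multiset.coe_toList,
      Finsupp.toMultiset_map]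
  rw [mon, mon, ← List.map_map]
  refine List.Perm.prod_eq' (hperm.map w) ?_
  exact List.pairwise_map.2 (List.pairwise_map.2 (List.pairwise_of_forall hcomm))

theorem algebraicIndependent_of_linearIndependent_mon {κ : Type*} {w : ι → E} {g : κ → ι}
    (hg : Function.Injective g) (hli : LinearIndependent F (mon w))
    {t : κ → Subalgebra.center F E} (ht : ∀ j, (t j : E) = w (g j)) :
    AlgebraicIndependent F t := by
  let f : MvPolynomial κ F →ₐ[F] E := (Subalgebra.center F E).val.comp (MvPolynomial.aeval t)
  have hfX : f ∘ MvPolynomial.X = w ∘ g := funext fun j => by simp [f, ht]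
  have hcomm (i j : κ) : Commute (w (g i)) (w (g j)) := by
    rw [← ht, ← ht]
    exact congrArg Subtype.val (mul_comm (t i) (t j))
  have hdisj : Disjoint _ (LinearMap.ker f.toLinearMap) :=
    disjoint_adjoin_ker_of_linearIndependent_mon f (w := MvPolynomial.X)
      (fun i j => by simp [mul_comm]) <| by
        rw [hfX, funext (mon_comp hcomm)]
        exact hli.comp _ (Finsupp.mapDomain_injective hg)
  rw [MvPolynomial.adjoin_range_X, Algebra.top_toSubmodule, top_disjoint, LinearMap.ker_eq_bot]
    at hdisj
  exact Function.Injective.of_comp (f := (Subalgebra.center F E).val) hdisj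

end Monomials

section Recognition

variable {F : Type u} [Field F] {n l : ℕ} {E : Type*} [DivisionRing E] [Algebra F E]

theorem mem_center_of_fractions_eq_top {B : Subalgebra F E} {hB : LeftOre B}
    (htop : fractions hB = ⊤) {z : E} (hz : ∀ b ∈ B, Commute z b) :
    z ∈ Subalgebra.center F E := by
  refine Subalgebra.mem_center_iff.2 fun q => ?_
  obtain ⟨b, hb, hb0, hbq⟩ := mem_fractions.1 (htop ▸ Subring.mem_top q : q ∈ fractions hB)
  refine mul_left_cancel₀ hb0 ?_
  rw [← mul_assoc, ← (hz _ hbq).eq, ← mul_assoc, ← mul_assoc, (hz b hb).eq]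

theorem isUnit_of_ne_zero_of_mem_center {z : Subalgebra.center F E} (hz : z ≠ 0) : IsUnit z := by
  have hz0 : (z : E) ≠ 0 := fun h => hz (Subtype.ext h)
  exact .of_mul_eq_one ⟨(z : E)⁻¹, Set.inv_mem_center z.2⟩ (Subtype.ext (mul_inv_cancel₀ hz0))

theorem exists_algHom_ratFun_center {t : Fin l → Subalgebra.center F E}
    (ht : AlgebraicIndependent F t) :
    ∃ c : RatFun F l →ₐ[F] Subalgebra.center F E,
      ∀ j, c (algebraMap (MvPolynomial (Fin l) F) _ (MvPolynomial.X j)) = t j := by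
  have hunit (p : (MvPolynomial (Fin l) F)⁰) :
      IsUnit (MvPolynomial.aeval t (p : MvPolynomial (Fin l) F)) :=
    isUnit_of_ne_zero_of_mem_center ((map_ne_zero_iff _ ht).2 (nonZeroDivisors.ne_zero p.2))
  exact ⟨IsLocalization.liftAlgHom hunit, fun j => by simp⟩

theorem exists_algHom_weylAlgebra {w : WeylIndex n l → E} (hw : IsWeylSystem w)
    (c : RatFun F l →ₐ[F] Subalgebra.center F E)
    (hc : ∀ j, (c (algebraMap (MvPolynomial (Fin l) F) _ (MvPolynomial.X j)) : E) = w (.inr j)) :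
    ∃ f : WeylAlgebra (RatFun F l) n →ₐ[F] E, f ∘ weylGen F n l = w := by
  let g : RatFun F l →ₐ[F] E := (Subalgebra.center F E).val.comp c
  let : Algebra (RatFun F l) E := RingHom.toAlgebra' g
    fun r x => (Subalgebra.mem_center_iff.1 (c r).2 x).symm
  have : IsScalarTower F (RatFun F l) E :=
    IsScalarTower.of_algebraMap_eq fun r => (g.commutes r).symm
  let f : WeylAlgebra (RatFun F l) n →ₐ[RatFun F l] E := RingQuot.liftAlgHom (RatFun F l)
    ⟨FreeAlgebra.lift (RatFun F l) fun a => w (.inl a), by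
      rintro _ _ (⟨i, j⟩ | ⟨i, j⟩ | ⟨i, j⟩)
      · simpa using (hw.commute (a := .inl (.inl i)) (b := .inl (.inl j)) rfl).eq
      · simpa using (hw.commute (a := .inl (.inr i)) (b := .inl (.inr j)) rfl).eq
      · have h := sub_eq_iff_eq_add'.1 (hw (.inl (.inr i)) (.inl (.inl j)))
        simpa [weylForm, apply_ite (FreeAlgebra.lift (RatFun F l) _)] using h⟩
  refine ⟨f.restrictScalars F, funext ?_⟩
  rintro (a | j)
  · simp [f, weylGen]
  · exact (f.commutes _).trans (hc j)

theorem injective_of_linearIndependent_mon {f : WeylAlgebra (RatFun F l) n →ₐ[F] E}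
    (hli : LinearIndependent F (mon (f ∘ weylGen F n l))) : Function.Injective f := by
  refine (injective_iff_map_eq_zero f).2 fun z hz => ?_
  obtain ⟨h, hh, hmem⟩ := exists_smul_mem_adjoin_weylGen z
  have hker : algebraMap _ (RatFun F l) h • z ∈ LinearMap.ker f.toLinearMap := by
    simp [Algebra.smul_def, hz]
  have hdisj := disjoint_adjoin_ker_of_linearIndependent_mon f
    ((isWeylSystem_weylGen F n l).almostCommute F) hli
  refine (smul_eq_zero.1 (Submodule.disjoint_def.1 hdisj _ hmem hker)).resolve_left ?_
  exact (map_ne_zero_iff _ (IsFractionRing.injective _ _)).2 hh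

variable {w : WeylIndex n l → E}

theorem IsWeylSystem.isWeylField_of_linearIndependent_mon (hw : IsWeylSystem w)
    (htop : fractions (leftOre_adjoin (hw.almostCommute F)) = ⊤)
    (hli : LinearIndependent F (mon w)) : IsWeylField F n l E := by
  have hcenter (j : Fin l) : w (.inr j) ∈ Subalgebra.center F E :=
    mem_center_of_fractions_eq_top htop fun b hb =>
      Algebra.commute_of_mem_adjoin_of_forall_mem_commute hb <| by
        rintro _ ⟨a, rfl⟩
        exact hw.commute (by rcases a with (a | a) | a <;> rfl)
  obtain ⟨c, hc⟩ := exists_algHom_ratFun_center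
    (algebraicIndependent_of_linearIndependent_mon Sum.inr_injective hli
      (t := fun j => ⟨w (.inr j), hcenter j⟩) fun _ => rfl)
  obtain ⟨f, rfl⟩ := exists_algHom_weylAlgebra hw c fun j => congrArg Subtype.val (hc j)
  refine ⟨f, injective_of_linearIndependent_mon hli, fun q => ?_⟩
  obtain ⟨b, hb, hb0, hbq⟩ := mem_fractions.1 (htop ▸ Subring.mem_top q : q ∈ fractions _)
  rw [Set.range_comp, ← AlgHom.map_adjoin] at hb hbq
  obtain ⟨s, -, rfl⟩ := hb
  obtain ⟨a, -, ha⟩ := hbq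
  exact ⟨a, s, ne_zero_of_map hb0, (eq_inv_mul_iff_mul_eq₀ hb0).2 ha.symm⟩

theorem IsWeylSystem.isWeylField_of_tdeg_eq (hw : IsWeylSystem w)
    (htop : fractions (leftOre_adjoin (hw.almostCommute F)) = ⊤)
    (ht : tdeg F E = ((2 * n + l : ℕ) : EReal)) : IsWeylField F n l E := by
  refine hw.isWeylField_of_linearIndependent_mon htop
    (linearIndependent_mon_of_tdeg_eq_card (hw.almostCommute F) htop (ht.trans ?_))
  simp [two_mul]

end Recognition

/-! ### Specialization of Weyl presentations -/

theorem trdeg_fractionRing_of_algEquiv {k Z : Type*} [Field k] [CommRing Z] [Algebra k Z] {r : ℕ}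
    (e : MvPolynomial (Fin r) k ≃ₐ[k] Z) : Algebra.trdeg k (FractionRing Z) = r := by
  have : IsDomain Z := e.toMulEquiv.symm.isDomain _
  have := IsLocalization.isAlgebraic (FractionRing Z) (nonZeroDivisors Z)
  have htrdeg : Algebra.trdeg k Z = r := by simpa using e.lift_trdeg_eq.symm
  rw [← trdeg_add_eq k Z, htrdeg, trdeg_eq_zero, add_zero]

theorem IsPartialHom.isWeylSystem {D E : Type*} [Ring D] [Ring E] {Γ : Subring (D × E)}
    (hΓ : IsPartialHom Γ) {n l : ℕ} {w : WeylIndex n l → D} {w' : WeylIndex n l → E}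
    (hw : IsWeylSystem w) (hw' : ∀ a, (w a, w' a) ∈ Γ) : IsWeylSystem w' :=
  (IsWeylSystem.of_map (w := fun a => (⟨(w a, w' a), hw' a⟩ : Γ)) hΓ.fst_injective hw).map
    ((RingHom.snd D E).comp Γ.subtype)

namespace ZCompatibleFamily

theorem adjoin_eq_top_of_span_eq_gen {K : ZCompatibleFamily.{u, v}} {g : Set K.ring}
    (hg : Submodule.span ℤ g = K.gen) : Algebra.adjoin ℤ g = ⊤ := by
  rw [← Algebra.toSubmodule_eq_top, eq_top_iff, ← K.fil_exhaustive]
  refine iSup_le fun m => ?_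
  rw [K.fil_eq, ← hg]
  exact one_sup_span_pow_le_adjoin g m

section Generation

variable {K : ZCompatibleFamily.{u, v}} {F : Type u} [Field F] [IsAlgClosed F]
  {S : Subring (SkewFrac (K.alg F))}

theorem skewFracHom_mem_of_gen_mem (hF : ∀ r, algebraMap F _ r ∈ S) {g : Set K.ring}
    (hg : Submodule.span ℤ g = K.gen) (hgS : ∀ a ∈ g, skewFracHom F (K.alg F) (1 ⊗ₜ a) ∈ S)
    (x : K.alg F) : skewFracHom F (K.alg F) x ∈ S := by
  let f : K.ring →+* SkewFrac (K.alg F) := (skewFracHom F (K.alg F) : _ →+* _).comp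
    (Algebra.TensorProduct.includeRight : K.ring →ₐ[ℤ] F ⊗[ℤ] K.ring).toRingHom
  have hring : ⊤ ≤ subalgebraOfSubring (S.comap f) := by
    rw [← adjoin_eq_top_of_span_eq_gen hg, Algebra.adjoin_le_iff]
    exact hgS
  induction x using TensorProduct.induction_on with
  | zero => exact (map_zero (skewFracHom F (K.alg F))).symm ▸ zero_mem _
  | add x y hx hy => exact (map_add (skewFracHom F (K.alg F)) x y).symm ▸ add_mem hx hy
  | tmul r a =>
    have hra : (r ⊗ₜ a : K.alg F) = r • (1 ⊗ₜ a) := by simp [TensorProduct.smul_tmul']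
    have ha : f a ∈ S := hring (Algebra.mem_top (x := a))
    rw [hra, map_smul, Algebra.smul_def]
    exact mul_mem (hF r) ha

theorem eq_top_of_gen_mem (hF : ∀ r, algebraMap F _ r ∈ S) (hinv : ∀ q ∈ S, q⁻¹ ∈ S)
    {g : Set K.ring} (hg : Submodule.span ℤ g = K.gen)
    (hgS : ∀ a ∈ g, skewFracHom F (K.alg F) (1 ⊗ₜ a) ∈ S) : S = ⊤ := by
  refine eq_top_iff.2 fun q _ => ?_
  obtain ⟨s, a, hs, hsa⟩ := exists_skewFracHom_mul_eq F q
  have hs' : skewFracHom F (K.alg F) s ≠ 0 :=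
    (map_ne_zero_iff _ (skewFracHom_injective F _)).2 hs
  rw [(eq_inv_mul_iff_mul_eq₀ hs').2 hsa]
  exact mul_mem (hinv _ (skewFracHom_mem_of_gen_mem hF hg hgS s))
    (skewFracHom_mem_of_gen_mem hF hg hgS a)

end Generation

section Specialization

variable {K : ZCompatibleFamily.{u, v}} {k : Type u} [Field k] [IsAlgClosed k] {ι : Type*}
  {w : ι → SkewFrac (K.alg k)}

theorem eventually_exists_mem_adjoin_spec {p : SkewFrac (K.alg k)}
    (hp : p ∈ Algebra.adjoin k (Set.range w)) :
    ∀ᶠ O : ValuationSubring k in genericFilter k,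
      ∀ (F : Type u) [Field F] [IsAlgClosed F] (φ : O →+* F) (w' : ι → SkewFrac (K.alg F)),
      (∀ a, (w a, w' a) ∈ K.spec O φ) →
      ∃ p' ∈ Algebra.adjoin F (Set.range w'), (p, p') ∈ K.spec O φ := by
  induction hp using Algebra.adjoin_induction with
  | mem x hx =>
    obtain ⟨a, rfl⟩ := hx
    exact .of_forall fun O F _ _ φ w' hw' => ⟨w' a, Algebra.subset_adjoin ⟨a, rfl⟩, hw' a⟩
  | algebraMap r =>
    filter_upwards [eventually_mem_genericFilter r] with O hr F _ _ φ w' _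
    exact ⟨_, algebraMap_mem _ _, algebraMap_mem_spec ⟨r, hr⟩⟩
  | add x y _ _ hx hy =>
    filter_upwards [hx, hy] with O hx hy F _ _ φ w' hw'
    obtain ⟨x', hx', hx⟩ := hx F φ w' hw'
    obtain ⟨y', hy', hy⟩ := hy F φ w' hw'
    exact ⟨x' + y', add_mem hx' hy', add_mem hx hy⟩
  | mul x y _ _ hx hy =>
    filter_upwards [hx, hy] with O hx hy F _ _ φ w' hw'
    obtain ⟨x', hx', hx⟩ := hx F φ w' hw'
    obtain ⟨y', hy', hy⟩ := hy F φ w' hw'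
    exact ⟨x' * y', mul_mem hx' hy', mul_mem hx hy⟩

theorem eventually_mem_fractions [Finite ι] {b q : SkewFrac (K.alg k)}
    (hb : b ∈ Algebra.adjoin k (Set.range w)) (hb0 : b ≠ 0)
    (hbq : b * q ∈ Algebra.adjoin k (Set.range w)) :
    ∀ᶠ O : ValuationSubring k in genericFilter k,
      ∀ (F : Type u) [Field F] [IsAlgClosed F] (φ : O →+* F) (w' : ι → SkewFrac (K.alg F))
        (hw' : AlmostCommute F w'), (∀ a, (w a, w' a) ∈ K.spec O φ) →
      ∀ q', (q, q') ∈ K.spec O φ → q' ∈ fractions (leftOre_adjoin hw') := by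
  filter_upwards [eventually_exists_mem_adjoin_spec hb, eventually_exists_mem_adjoin_spec hbq,
    eventually_exists_ne_zero_mem_spec hb0] with O hb hbq hb0 F _ _ φ w' _ hww' q' hq
  obtain ⟨b', hb', hbb'⟩ := hb F φ w' hww'
  obtain ⟨c', hc', hcc'⟩ := hbq F φ w' hww'
  obtain ⟨b'', hb'', hbb''⟩ := hb0 F φ
  obtain rfl := isPartialHom_spec.eq_of_mem hbb' hbb''
  obtain rfl := isPartialHom_spec.eq_of_mem (mul_mem hbb' hq) hcc'
  exact mem_fractions.2 ⟨b', hb', hb'', hc'⟩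

theorem eventually_exists_isWeylSystem {n l : ℕ}
    {f : WeylAlgebra (RatFun k l) n →ₐ[k] SkewFrac (K.alg k)}
    (hf : IsSkewFractionMap f.toRingHom) :
    ∀ᶠ O : ValuationSubring k in genericFilter k,
      ∀ (F : Type u) [Field F] [IsAlgClosed F], (O →+* F) →
      ∃ (w : WeylIndex n l → SkewFrac (K.alg F)) (hw : IsWeylSystem w),
        fractions (leftOre_adjoin (hw.almostCommute F)) = ⊤ := by
  let w : WeylIndex n l → SkewFrac (K.alg k) := f ∘ weylGen k n l
  have hw : IsWeylSystem w := (isWeylSystem_weylGen k n l).map f.toRingHom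
  obtain ⟨g, hg⟩ := K.gen_fg
  choose b hb hb0 hbq using fun v : K.ring =>
    exists_mul_mem_adjoin_weylGen hf (skewFracHom k (K.alg k) (1 ⊗ₜ v))
  filter_upwards [Filter.eventually_all.2 fun a => eventually_exists_mem_spec (w a),
    (Filter.eventually_all_finset g).2 fun v _ => eventually_mem_fractions (hb v) (hb0 v) (hbq v)]
    with O hspec hfrac F _ _ φ
  choose w' hw' using fun a => hspec a F φ
  have hsys : IsWeylSystem w' := isPartialHom_spec.isWeylSystem hw hw'
  refine ⟨w', hsys, eq_top_of_gen_mem (fun r => mem_fractions_of_mem (algebraMap_mem _ r))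
    (fun _ => inv_mem_fractions) hg fun v hv => ?_⟩
  have hv' := tmul_mem_spec (φ := φ) 1 v
  rw [map_one, OneMemClass.coe_one] at hv'
  exact hfrac v hv F φ w' (hsys.almostCommute F) hw' _ hv'

end Specialization

variable (K : ZCompatibleFamily.{u, v})

theorem finrank_gen_baseChange (F : Type u) [Field F] [IsAlgClosed F] :
    Module.finrank F (K.gen.baseChange F) = Module.finrank ℤ K.gen := by
  have : Module.Finite ℤ K.gen := Module.Finite.iff_fg.2 K.gen_fg
  have : Module.Free ℤ K.gen := Module.free_of_finite_type_torsion_free'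
  exact (LinearMap.finrank_range_of_inj (K.gen_baseChange F)).trans Module.finrank_baseChange

theorem trdeg_frac_center (k : Type u) [Field k] [IsAlgClosed k] [CharZero k] :
    Algebra.trdeg k (FractionRing (Subalgebra.center k (K.alg k))) = K.numCentral := by
  obtain ⟨e, -⟩ := K.center_polynomial k
  exact trdeg_fractionRing_of_algEquiv (Z := Subalgebra.center k (K.alg k)) e

theorem exists_isWeylField_of_gelfandKirillov {k : Type u} [Field k] [IsAlgClosed k] [CharZero k]
    (h : K.GelfandKirillov k) :
    ∃ n l : ℕ, Module.finrank ℤ K.gen = 2 * n + l ∧ l = K.numCentral ∧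
      ∃ m : ℤ, m ≠ 0 ∧ ∀ (F : Type u) [Field F] [IsAlgClosed F], (m : F) ≠ 0 →
        IsWeylField F n l (SkewFrac (K.alg F)) := by
  obtain ⟨n, l, ⟨f, hf⟩, ht, hl⟩ := h
  rw [K.tdeg_frac, K.finrank_gen_baseChange, Nat.cast_inj] at ht
  rw [K.trdeg_frac_center, Nat.cast_inj] at hl
  obtain ⟨s, hs⟩ := exists_finset_of_eventually_genericFilter (eventually_exists_isWeylSystem hf)
  obtain ⟨m, hm0, hm⟩ := exists_forall_exists_valuationSubring_hom s
  refine ⟨n, l, ht, hl.symm, m, hm0, fun F _ _ hmF => ?_⟩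
  obtain ⟨O, hO, ⟨φ⟩⟩ := hm F hmF
  obtain ⟨w, hw, htop⟩ := hs O hO F φ
  exact hw.isWeylField_of_tdeg_eq htop (by rw [K.tdeg_frac, K.finrank_gen_baseChange, ht])

end ZCompatibleFamily

end GK

end

theorem mainTheorem3 (K : GK.ZCompatibleFamily.{u, v})
    (h : ∃ (k : Type u) (_ : Field k) (_ : IsAlgClosed k) (_ : CharZero k), K.GelfandKirillov k) :
    (∀ (k : Type u) [Field k] [IsAlgClosed k] [CharZero k], K.GelfandKirillov k) ∧
    ∃ N : ℕ, ∀ (p : ℕ) [Fact p.Prime], N < p →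
      ∀ (F : Type u) [Field F] [IsAlgClosed F] [CharP F p], K.ModularGelfandKirillov F := by
  obtain ⟨k, _, _, _, h⟩ := h
  obtain ⟨n, l, hdim, hl, m, hm0, hm⟩ := K.exists_isWeylField_of_gelfandKirillov h
  refine ⟨fun k' _ _ _ => ⟨n, l, hm k' (Int.cast_ne_zero.2 hm0), ?_, ?_⟩,
    m.natAbs, fun p _ hp F _ _ _ => ⟨n, l, hm F fun h0 => ?_⟩⟩
  · rw [K.tdeg_frac, K.finrank_gen_baseChange, hdim]
  · rw [K.trdeg_frac_center, hl]
  · rw [CharP.intCast_eq_zero_iff F p] at h0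
    have := Nat.le_of_dvd (Int.natAbs_pos.2 hm0) (Int.natCast_dvd.1 h0)
    omega
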